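/- **Setting.** Write $\log=\log_2$ (with the conventions $0^0=1$ and $0^a=0$ for $a\neq0$ for powers of $\log 1=0$). A stream is a sequence $x=(x_1,x_2,\dots)$ with $x_i\in[0,1]$. A randomized online algorithm $\mathcal A$ outputs at every step $t$ a real number $\mathcal A(x)_t$ that depends only on $x_1,\dots,x_t$ and on its coin throws. For a non-decreasing $f:\mathbb N\to\mathbb R_{\ge0}$, $\mathcal A$ is *$\varepsilon$-differentially private with expiration $f$* if for all $\tau\ge1$, all measurable $S\subseteq\mathbb R^\tau$, all streams $x$, all $1\le j\le\tau$ and every stream $x'$ that differs from $x$ only in its $j$-th entry, with $|x_j-x'_j|\le1$, $$\Pr[(\mathcal A(x)_t)_{t=1}^\tau\in S]\le e^{f(\tau-j)\varepsilon}\,\Pr[(\mathcal A(x')_t)_{t=1}^\tau\in S].$$ **The algorithm.** For $\ell\ge0$ the dyadic intervals of level $\ell$ are $[k2^\ell,(k+1)2^\ell-1]$, $k\ge1$. Let $\lambda>0$, $\varepsilon>0$, $B\in\mathbb N$. The algorithm $\mathcal A=\mathcal A_{\lambda,\varepsilon,B}$ uses independent Laplace variables $Z_I$, one for each dyadic interval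 $I$, where $Z_I\sim\mathrm{Lap}\big((1+\ell)^{1-\lambda}/\varepsilon\big)$ if $I$ has level $\ell$. It outputs $0$ at the steps $t\le B$, and $\sum_{i=1}^{t-B}x_i+\sum_{I\ni t-B}Z_I$ at the steps $t>B$. **Model of computation.** A program is a finite list of instructions for a random-access machine with a memory for natural numbers (constants of the program, copying, $\pm1$, a jump if two cells are equal) and a memory for real numbers (conversion from a natural number, copying, $+,-,\times,\div$, powers), both initially zero except for the parameters $B,\lambda,\varepsilon$, and both with direct and indirect addressing. One instruction reads the next stream entry, one emits an output, and one draws a fresh independent Laplace variable of a given scale. Each instruction takes unit time. Space is the number of distinct memory cells accessed. **Theorem.** There is one program $P$ such that for every $\lambda>0$ with $\lambda\neq3/2$ there is a constant $C>0$ depending only on $\lambda$ such that for all $\varepsilon>0$ and $B\in\mathbb N$ the following hold. 1. (Privacy.) $\mathcal A$ is $\varepsilon$-differentially private with every non-decreasing expiration function $f$ with $f\ge g$ pointwise, where $g(d)=0$ for $d<B$ and $g(d)=C\,(1+\log^\lambda(d-B+1))$ for $d\ge B$. Moreover, for every stream $x$: 2. (Implementation, time and space.) On the stream $x$ the sequence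 of outputs of $P$ with parameters $\lambda,\varepsilon,B$ has the law of $(\mathcal A(x)_t)_t$. For every $t\ge1$ and all values of the random draws, $P$ emits its $t$-th output after having read exactly $t$ stream entries, within $C\,t$ steps from the start (that is, $O(1)$ amortized time per input/output pair), having used at most $C\,(1+B+\log t)$ memory cells. 3. (Squared error.) For every $t\ge1$, $$\mathbb E\Big[\big(\mathcal A(x)_t-\textstyle\sum_{i=1}^tx_i\big)^2\Big]\le C\Big(B^2+\frac{1+\log^{3-2\lambda}t}{\varepsilon^2}\Big),$$ and the random variable is integrable. 4. (Error with high probability.) Let $q=\max(1/2,\,3/2-\lambda)$. For every $t\ge1$ and every $\beta\in(0,1)$, with probability at least $1-\beta$, $$\big|\mathcal A(x)_t-\textstyle\sum_{i=1}^tx_i\big|\le C\Big(B+\frac{\log^q(t)\sqrt{\log(1/\beta)}+(1+\log^{1-\lambda}t)\log(1/\beta)}{\varepsilon}\Big).$$ 5. For every $c>0$ there is a constant $C_c>0$ depending only on $\lambda$ and $c$ such that for all $\varepsilon>0$, $B\in\mathbb N$, streams $x$, $t\ge1$ and $\beta\in(0,1)$ with $\beta\ge t^{-c}$, with probability at least $1-\beta$,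 $$\big|\mathcal A(x)_t-\textstyle\sum_{i=1}^tx_i\big|\le C_c\Big(B+\frac{\log^q(t)\sqrt{\log(1/\beta)}}{\varepsilon}\Big).$$ -/

import Mathlib

open MeasureTheory

noncomputable section

namespace GradualExpiration

/-! ### Streams, online mechanisms, privacy with expiration -/

/-- Time starts at step 1: a stream is a function `x : ℕ → ℝ` whose entries are `x 1, x 2, …`
(the value `x 0` is never used).  All entries lie in the domain `D`. -/
def IsStreamIn (D : Set ℝ) (x : ℕ → ℝ) : Prop := ∀ i, 1 ≤ i → x i ∈ D

/-- A randomized online algorithm with real outputs, whose coin throws are a point of the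
probability space `(Ω, law)`: at step `t` it outputs a value that depends only on
`x 1, …, x t` and on the coin throws. -/
structure OnlineMechanism (Ω : Type) [MeasurableSpace Ω] where
  law : Measure Ω
  isProbabilityMeasure_law : IsProbabilityMeasure law
  output : (ℕ → ℝ) → ℕ → Ω → ℝ
  measurable_output : ∀ x t, Measurable (output x t)
  online : ∀ x x' t, (∀ i, 1 ≤ i → i ≤ t → x i = x' i) → output x t = output x' t

/-- `ε`-differential privacy with expiration function `g`, for streams with entries in `D`:
for every horizon `τ ≥ 1`, every stream, every position `1 ≤ j ≤ τ` and every replacement `y` of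
the entry `x j` with `|x j - y| ≤ 1`, the laws of the first `τ` outputs on the two streams are
within the factor `exp (g (τ - j) * ε)` of each other on every measurable set. -/
def IsDPWithExpiration {Ω : Type} [MeasurableSpace Ω] (A : OnlineMechanism Ω) (D : Set ℝ)
    (ε : ℝ) (g : ℕ → ℝ) : Prop :=
  Monotone g ∧ (∀ d, 0 ≤ g d) ∧
  ∀ τ : ℕ, 1 ≤ τ → ∀ S : Set (Fin τ → ℝ), MeasurableSet S →
  ∀ x : ℕ → ℝ, IsStreamIn D x → ∀ j : ℕ, 1 ≤ j → j ≤ τ → ∀ y ∈ D, |x j - y| ≤ 1 →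
    A.law {ω | (fun i : Fin τ => A.output x (i.val + 1) ω) ∈ S} ≤
      ENNReal.ofReal (Real.exp (g (τ - j) * ε)) *
        A.law {ω | (fun i : Fin τ => A.output (Function.update x j y) (i.val + 1) ω) ∈ S}

/-! ### The Laplace distribution -/

/-- The density of the centered Laplace distribution of scale `b`. -/
def laplacePDF (b x : ℝ) : ℝ := 1 / (2 * b) * Real.exp (-|x| / b)

/-- The centered Laplace distribution of scale `b > 0` (a point mass at `0` for `b ≤ 0`). -/
def laplaceMeasure (b : ℝ) : Measure ℝ :=
  if 0 < b then volume.withDensity (fun x => ENNReal.ofReal (laplacePDF b x))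
  else Measure.dirac 0

theorem lintegral_laplacePDF {b : ℝ} (hb : 0 < b) :
    ∫⁻ x, ENNReal.ofReal (laplacePDF b x) = 1 := by
  have h1 : (fun x : ℝ => laplacePDF b x)
      = fun x : ℝ => (fun u : ℝ => 1 / (2 * b) * Real.exp (-(1 / b) * u)) |x| := by
    funext x
    simp only [laplacePDF]
    congr 2
    ring
  have h2 : ∫ x, laplacePDF b x = 1 := by
    rw [h1, integral_comp_abs (f := fun u : ℝ => 1 / (2 * b) * Real.exp (-(1 / b) * u)),
      integral_const_mul, integral_exp_mul_Ioi (by simpa using hb)]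
    simp
    field_simp
  have hI : Integrable (fun x : ℝ => laplacePDF b x) :=
    Integrable.of_integral_ne_zero (by rw [h2]; exact one_ne_zero)
  rw [← ofReal_integral_eq_lintegral_ofReal hI
    (Filter.Eventually.of_forall fun x => by simp only [laplacePDF]; positivity), h2,
    ENNReal.ofReal_one]

instance isProbabilityMeasure_laplaceMeasure (b : ℝ) :
    IsProbabilityMeasure (laplaceMeasure b) := by
  unfold laplaceMeasure
  split_ifs with hb
  · exact ⟨by rw [withDensity_apply _ MeasurableSet.univ, Measure.restrict_univ,
      lintegral_laplacePDF hb]⟩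
  · infer_instance

/-! ### The counting algorithm -/

/-- The dyadic interval `[k * 2 ^ ℓ, (k + 1) * 2 ^ ℓ - 1]` of level `ℓ`, with `k ≥ 1`. -/
structure DyadicInterval where
  level : ℕ
  k : ℕ
  k_pos : 1 ≤ k

/-- The set of the integer points of a dyadic interval. -/
def DyadicInterval.toSet (I : DyadicInterval) : Set ℕ :=
  Set.Icc (I.k * 2 ^ I.level) ((I.k + 1) * 2 ^ I.level - 1)

theorem finite_setOf_mem_toSet (s : ℕ) : {I : DyadicInterval | s ∈ I.toSet}.Finite := by
  refine Set.Finite.of_finite_image (f := fun I : DyadicInterval => (I.level, I.k)) ?_ ?_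
  · refine ((Set.finite_Iic s).prod (Set.finite_Iic s)).subset ?_
    rintro _ ⟨I, hI, rfl⟩
    have h1 : I.k * 2 ^ I.level ≤ s := hI.1
    have h2 : I.level < 2 ^ I.level := Nat.lt_two_pow_self
    have h3 := I.k_pos
    refine ⟨?_, ?_⟩
    · simp only [Set.mem_Iic]
      nlinarith
    · simp only [Set.mem_Iic]
      nlinarith
  · rintro ⟨a, b, c⟩ _ ⟨a', b', c'⟩ _ h
    simp only [Prod.mk.injEq] at h
    obtain ⟨rfl, rfl⟩ := h
    rfl

/-- The finite set of the dyadic intervals that contain `s`. -/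
def dyadicAt (s : ℕ) : Finset DyadicInterval := (finite_setOf_mem_toSet s).toFinset

/-- The scale `(1 + ℓ) ^ (1 - lam) / ε` of the noise on the intervals of level `ℓ`. -/
def noiseScale (lam ε : ℝ) (l : ℕ) : ℝ := (1 + (l : ℝ)) ^ (1 - lam) / ε

/-- The joint law of the independent Laplace variables, one for each dyadic interval. -/
def noiseLaw (lam ε : ℝ) : Measure (DyadicInterval → ℝ) :=
  Measure.infinitePi fun I => laplaceMeasure (noiseScale lam ε I.level)

/-- The continual counting algorithm with delay `B`: it outputs `0` in the first `B` steps, and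
`∑ i ≤ t - B, x i` plus the noise variables of all dyadic intervals containing `t - B` at every
step `t > B`. -/
def countingMechanism (lam ε : ℝ) (B : ℕ) : OnlineMechanism (DyadicInterval → ℝ) where
  law := noiseLaw lam ε
  isProbabilityMeasure_law := by unfold noiseLaw; infer_instance
  output x t z :=
    if t ≤ B then 0 else ∑ i ∈ Finset.Icc 1 (t - B), x i + ∑ I ∈ dyadicAt (t - B), z I
  measurable_output x t := by
    split_ifs
    · fun_prop
    · fun_prop
  online x x' t h := by
    funext z
    split_ifs
    · rfl
    · congr 1
      refine Finset.sum_congr rfl fun i hi => ?_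
      rw [Finset.mem_Icc] at hi
      exact h i hi.1 (by omega)

/-- The error of the output at step `t`, for the coin throws `z`. -/
def errorAt (lam ε : ℝ) (B : ℕ) (x : ℕ → ℝ) (t : ℕ) (z : DyadicInterval → ℝ) : ℝ :=
  (countingMechanism lam ε B).output x t z - ∑ i ∈ Finset.Icc 1 t, x i

/-- The expiration function: `0` for `d < B`, and `C * (1 + log₂ (d - B + 1) ^ lam)` for
`d ≥ B`. -/
def expirationBound (C lam : ℝ) (B d : ℕ) : ℝ :=
  if d < B then 0 else C * (1 + Real.logb 2 ((d : ℝ) - B + 1) ^ lam)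

/-! ### Streaming random-access machines

The machine has two zero-initialized memories, one whose cells hold natural numbers and one whose
cells hold real numbers.  Every instruction takes one unit of time.  Natural numbers change only
by `±1`, by copying, or by loading a constant of the program, and serve as counters and addresses;
there is no branching on real numbers and no rounding.  Space is the number of distinct memory
cells that have been accessed. -/

/-- An operand: cell `n`, or the cell whose address is stored in natural-number cell `n`. -/
inductive Addr where
  | direct (n : ℕ)
  | indirect (n : ℕ)

/-- Arithmetic on real numbers; `pow` is `a ^ b`. -/
inductive RealOp where
  | add
  | sub
  | mul
  | div
  | pow

/-- The instructions; `d` is always the destination. -/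
inductive Instr where
  /-- store the constant `c` in natural-number cell `d` -/
  | const (d : Addr) (c : ℕ)
  /-- copy natural-number cell `s` to natural-number cell `d` -/
  | copy (d s : Addr)
  /-- increment natural-number cell `d` -/
  | incr (d : Addr)
  /-- decrement natural-number cell `d` (`0` stays `0`) -/
  | decr (d : Addr)
  /-- continue at `target` if the natural-number cells `a` and `b` are equal -/
  | jumpEq (a b : Addr) (target : ℕ)
  /-- write the value of natural-number cell `s` to real cell `d` -/
  | cast (d s : Addr)
  /-- copy real cell `s` to real cell `d` -/
  | move (d s : Addr)
  /-- write `op a b` to real cell `d`, for the real cells `a` and `b` -/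
  | arith (op : RealOp) (d a b : Addr)
  /-- draw a fresh Laplace variable, whose scale is in real cell `s`, into real cell `d` -/
  | laplace (d s : Addr)
  /-- read the next entry of the stream into real cell `d` -/
  | input (d : Addr)
  /-- emit the content of real cell `s` as the next output -/
  | output (s : Addr)

/-- A program is a finite list of instructions. -/
abbrev Program := List Instr

/-- A state: program counter, the two memories, the numbers of Laplace draws, of stream entries
read and of outputs emitted so far, and the last output. -/
structure State where
  pc : ℕ
  nat : ℕ → ℕ
  real : ℕ → ℝ
  drawn : ℕ
  consumed : ℕ
  emitted : ℕ
  last : ℝ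

/-- The address that an operand denotes. -/
def State.addr (σ : State) : Addr → ℕ
  | .direct n => n
  | .indirect n => σ.nat n

/-- Write `v` to the natural-number cell `d` and go to the next instruction. -/
def State.setNat (σ : State) (d : Addr) (v : ℕ) : State :=
  { σ with pc := σ.pc + 1, nat := Function.update σ.nat (σ.addr d) v }

/-- Write `v` to the real cell `d` and go to the next instruction. -/
def State.setReal (σ : State) (d : Addr) (v : ℝ) : State :=
  { σ with pc := σ.pc + 1, real := Function.update σ.real (σ.addr d) v }

/-- The value of an arithmetic operation. -/
def RealOp.eval : RealOp → ℝ → ℝ → ℝ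
  | .add, a, b => a + b
  | .sub, a, b => a - b
  | .mul, a, b => a * b
  | .div, a, b => a / b
  | .pow, a, b => a ^ b

/-- The effect of one instruction, on the stream `x` and with the source of randomness `ω`.  The
entries of `ω` will be independent of law `Lap(1)`, and the `n`-th draw, of scale `b`, has the
value `b * ω n`, which has law `Lap(b)`. -/
def Instr.exec (x ω : ℕ → ℝ) (σ : State) : Instr → State
  | .const d c => σ.setNat d c
  | .copy d s => σ.setNat d (σ.nat (σ.addr s))
  | .incr d => σ.setNat d (σ.nat (σ.addr d) + 1)
  | .decr d => σ.setNat d (σ.nat (σ.addr d) - 1)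
  | .jumpEq a b target =>
      { σ with pc := if σ.nat (σ.addr a) = σ.nat (σ.addr b) then target else σ.pc + 1 }
  | .cast d s => σ.setReal d (σ.nat (σ.addr s) : ℝ)
  | .move d s => σ.setReal d (σ.real (σ.addr s))
  | .arith op d a b => σ.setReal d (op.eval (σ.real (σ.addr a)) (σ.real (σ.addr b)))
  | .laplace d s =>
      { σ.setReal d (σ.real (σ.addr s) * ω σ.drawn) with drawn := σ.drawn + 1 }
  | .input d => { σ.setReal d (x (σ.consumed + 1)) with consumed := σ.consumed + 1 }
  | .output s =>
      { σ with pc := σ.pc + 1, emitted := σ.emitted + 1, last := σ.real (σ.addr s) }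

/-- The cells accessed for an operand in the natural-number memory; `Sum.inl n` and `Sum.inr n`
are the `n`-th cells of the natural-number memory and of the real memory. -/
def State.natCells (σ : State) : Addr → Finset (ℕ ⊕ ℕ)
  | .direct n => {Sum.inl n}
  | .indirect n => {Sum.inl n, Sum.inl (σ.nat n)}

/-- The cells accessed for an operand in the real memory. -/
def State.realCells (σ : State) : Addr → Finset (ℕ ⊕ ℕ)
  | .direct n => {Sum.inr n}
  | .indirect n => {Sum.inl n, Sum.inr (σ.nat n)}

/-- The cells that an instruction reads or writes. -/
def Instr.cells (σ : State) : Instr → Finset (ℕ ⊕ ℕ)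
  | .const d _ => σ.natCells d
  | .copy d s => σ.natCells d ∪ σ.natCells s
  | .incr d => σ.natCells d
  | .decr d => σ.natCells d
  | .jumpEq a b _ => σ.natCells a ∪ σ.natCells b
  | .cast d s => σ.realCells d ∪ σ.natCells s
  | .move d s => σ.realCells d ∪ σ.realCells s
  | .arith _ d a b => σ.realCells d ∪ σ.realCells a ∪ σ.realCells b
  | .laplace d s => σ.realCells d ∪ σ.realCells s
  | .input d => σ.realCells d
  | .output s => σ.realCells s

/-- One step of a program; it stops when the program counter leaves the program. -/
def Program.step (P : Program) (x ω : ℕ → ℝ) (σ : State) : State :=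
  match P[σ.pc]? with
  | some i => i.exec x ω σ
  | none => σ

/-- The initial state: the parameters `B`, `lam` and `ε` are in natural-number cell 0 and in the
real cells 0 and 1; all other cells hold 0. -/
def initialState (lam ε : ℝ) (B : ℕ) : State where
  pc := 0
  nat := Function.update (fun _ => 0) 0 B
  real := Function.update (Function.update (fun _ => 0) 0 lam) 1 ε
  drawn := 0
  consumed := 0
  emitted := 0
  last := 0

/-- The state after `n` steps. -/
def Program.run (P : Program) (lam ε : ℝ) (B : ℕ) (x ω : ℕ → ℝ) (n : ℕ) : State :=
  (P.step x ω)^[n] (initialState lam ε B)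

/-- The number of distinct cells accessed in the first `n` steps. -/
def Program.cellsUsed (P : Program) (lam ε : ℝ) (B : ℕ) (x ω : ℕ → ℝ) (n : ℕ) : ℕ :=
  ((Finset.range n).biUnion fun m =>
    match P[(P.run lam ε B x ω m).pc]? with
    | some i => i.cells (P.run lam ε B x ω m)
    | none => ∅).card

/-- The number of steps executed until the `t`-th output has been emitted (meaningful only if
there is a `t`-th output). -/
def Program.outputTime (P : Program) (lam ε : ℝ) (B : ℕ) (x ω : ℕ → ℝ) (t : ℕ) : ℕ :=
  sInf {n | t ≤ (P.run lam ε B x ω n).emitted}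

/-- The `t`-th output (and `0` for `t = 0`). -/
def Program.outputAt (P : Program) (lam ε : ℝ) (B : ℕ) (x ω : ℕ → ℝ) (t : ℕ) : ℝ :=
  (P.run lam ε B x ω (P.outputTime lam ε B x ω t)).last

/-- The law of the source of randomness: independent variables of law `Lap(1)`. -/
def sourceLaw : Measure (ℕ → ℝ) := Measure.infinitePi fun _ => laplaceMeasure 1

/-- On the stream `x`, the sequence of the outputs of the program has the law of the sequence of
the outputs of the counting algorithm. -/
def Program.Implements (P : Program) (lam ε : ℝ) (B : ℕ) (x : ℕ → ℝ) : Prop :=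
  sourceLaw.map (fun ω t => P.outputAt lam ε B x ω t) =
    (noiseLaw lam ε).map (fun z t => (countingMechanism lam ε B).output x t z)

/-- With the source of randomness `ω`, the program emits its `t`-th output after it has read
exactly `t` entries of the stream, within `time` steps from the start, and with at most `space`
memory cells accessed until then. -/
def Program.EmitsWithin (P : Program) (lam ε : ℝ) (B : ℕ) (x ω : ℕ → ℝ) (t : ℕ)
    (time space : ℝ) : Prop :=
  (P.run lam ε B x ω (P.outputTime lam ε B x ω t)).emitted = t ∧
  (P.run lam ε B x ω (P.outputTime lam ε B x ω t)).consumed = t ∧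
  (P.outputTime lam ε B x ω t : ℝ) ≤ time ∧
  (P.cellsUsed lam ε B x ω (P.outputTime lam ε B x ω t) : ℝ) ≤ space

end GradualExpiration

end

namespace GradualExpiration

/-! Privacy: suppose `x j` is replaced by `y`, and `n` prefix sums containing it have been released.
The integers from `j` to `j + n - 1` are covered exactly once by dyadic intervals starting at or
after `j`, at most one per level up to `clog₂ n` (`exists_dyadic_partition`). Shifting the noise of
these intervals by `y - x j` turns the outputs on one stream into those on the other
(`countingMechanism_law_le`). The shift costs a factor at most the exponential of the sum of the
inverse scales, `ε ∑ (1 + ℓ) ^ (lam - 1)`, which is of order `ε (1 + log ^ lam n)` because `lam >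
0`.

Error: the delay omits at most `B` entries; the rest is a sum of independent Laplace variables, one
per level up to `log t`. The sum of the squared scales `(1 + ℓ) ^ (2 - 2 lam) / ε ^ 2` grows like a
power of `log t` or stays bounded, the harmonic case `lam = 3 / 2` being excluded. A bound on the
moment generating function gives the second moment and a Bernstein tail. When `β` is close to 1 the
two-sided tail bound is void while the claimed radius tends to 0. There `sum_laplace_concentration`
uses that a sum of Laplace variables is symmetric and unimodal: a long interval is covered by short
ones, none likelier than the centered one.

Program: incrementing a binary counter from `s` to `s + 1` touches exactly the bits of the levels
whose dyadic interval changes, so the noise is refreshed along the carry. Legendre's formula makes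
this amortized constant time. Each interval is assigned a fixed draw index, injectively
(`drawIndex_injective`), so the run agrees pointwise with the mechanism after relabelling the
source, and hence in law. -/

/-! ### One Laplace variable: shifts, scaling, exponential moments, convolution -/

theorem laplacePDF_nonneg {b : ℝ} (hb : 0 < b) (x : ℝ) : 0 ≤ laplacePDF b x := by
  unfold laplacePDF
  positivity

@[fun_prop]
theorem measurable_laplacePDF (b : ℝ) : Measurable (laplacePDF b) := by
  unfold laplacePDF
  fun_prop

theorem lintegral_laplaceMeasure {b : ℝ} (hb : 0 < b) {f : ℝ → ENNReal} (hf : Measurable f) :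
    ∫⁻ x, f x ∂laplaceMeasure b = ∫⁻ x, ENNReal.ofReal (laplacePDF b x) * f x := by
  rw [laplaceMeasure, if_pos hb, lintegral_withDensity_eq_lintegral_mul _ (by fun_prop) hf]
  rfl

/-- By the triangle inequality the density changes at most by the factor `exp (|a| / b)` under
translation by `a`. -/
theorem lintegral_laplaceMeasure_le_shift {b : ℝ} (hb : 0 < b) (a : ℝ) {f : ℝ → ENNReal}
    (hf : Measurable f) :
    ∫⁻ x, f x ∂laplaceMeasure b ≤
      ENNReal.ofReal (Real.exp (|a| / b)) * ∫⁻ x, f (x + a) ∂laplaceMeasure b := by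
  rw [lintegral_laplaceMeasure hb hf,
    lintegral_laplaceMeasure hb (f := fun x => f (x + a)) (by fun_prop),
    ← lintegral_const_mul _ (by fun_prop), ← lintegral_add_right_eq_self _ a]
  refine lintegral_mono fun x => ?_
  simp only
  rw [← mul_assoc, ← ENNReal.ofReal_mul (by positivity)]
  gcongr
  unfold laplacePDF
  rw [mul_left_comm, ← Real.exp_add]
  gcongr
  rw [← add_div]
  gcongr
  have := abs_sub_abs_le_abs_sub x (x + a)
  simp only [sub_add_cancel_left, abs_neg] at this
  linarith

theorem map_mul_laplaceMeasure {b : ℝ} (hb : 0 < b) :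
    (laplaceMeasure 1).map (fun x => b * x) = laplaceMeasure b := by
  refine Measure.ext_of_lintegral _ fun f hf => ?_
  have key : ∀ h : ℝ → ENNReal, Measurable h →
      ∫⁻ y, h y = ENNReal.ofReal b * ∫⁻ x, h (b * x) := fun h hh => by
    conv_lhs => rw [← Real.smul_map_volume_mul_left hb.ne']
    rw [lintegral_smul_measure, lintegral_map hh (by fun_prop), smul_eq_mul, abs_of_pos hb]
  rw [lintegral_map hf (by fun_prop), lintegral_laplaceMeasure hb hf,
    lintegral_laplaceMeasure one_pos (f := fun x => f (b * x)) (by fun_prop),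
    key (fun x => ENNReal.ofReal (laplacePDF b x) * f x) (by fun_prop), ← lintegral_const_mul _ (by fun_prop)]
  refine lintegral_congr fun x => ?_
  rw [← mul_assoc, ← ENNReal.ofReal_mul (by positivity)]
  congr 2
  simp only [laplacePDF, abs_mul, abs_of_pos hb]
  field_simp

/-- The two half-line integrals add up to `1 / (1 - (b θ) ^ 2)`, and `(1 - u) (1 + 2 u) ≥ 1` for `0
≤ u ≤ 1 / 4`. A sub-Gaussian bound holds only in this bounded range of `θ`. -/
theorem integrable_exp_laplaceMeasure {b θ : ℝ} (hb : 0 < b) (hθ : |b * θ| ≤ 1 / 2) :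
    Integrable (fun x => Real.exp (θ * x)) (laplaceMeasure b) ∧
      ∫ x, Real.exp (θ * x) ∂laplaceMeasure b ≤ Real.exp (2 * (b ^ 2 * θ ^ 2)) := by
  obtain ⟨h1, h2⟩ := abs_le.1 hθ
  have hp : 0 < 1 / b + θ := by
    have : 0 < (1 / b + θ) * b := by field_simp; linarith
    exact pos_of_mul_pos_left this hb.le
  have hm : θ - 1 / b < 0 := by
    have : 0 < (1 / b - θ) * b := by field_simp; linarith
    linarith [pos_of_mul_pos_left this hb.le]
  have e1 : Set.EqOn (fun x => laplacePDF b x * Real.exp (θ * x))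
      (fun x => 1 / (2 * b) * Real.exp ((1 / b + θ) * x)) (Set.Iic 0) := by
    intro x hx
    simp only [laplacePDF, abs_of_nonpos (Set.mem_Iic.1 hx)]
    rw [mul_assoc, ← Real.exp_add]
    congr 2
    field_simp
    try ring
  have e2 : Set.EqOn (fun x => laplacePDF b x * Real.exp (θ * x))
      (fun x => 1 / (2 * b) * Real.exp ((θ - 1 / b) * x)) (Set.Ioi 0) := by
    intro x hx
    simp only [laplacePDF, abs_of_pos (Set.mem_Ioi.1 hx)]
    rw [mul_assoc, ← Real.exp_add]
    congr 2
    field_simp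
    try ring
  have i1 : IntegrableOn (fun x => laplacePDF b x * Real.exp (θ * x)) (Set.Iic 0) :=
    (integrableOn_congr_fun e1 measurableSet_Iic).2 ((integrableOn_exp_mul_Iic hp 0).const_mul _)
  have i2 : IntegrableOn (fun x => laplacePDF b x * Real.exp (θ * x)) (Set.Ioi 0) :=
    (integrableOn_congr_fun e2 measurableSet_Ioi).2 ((integrableOn_exp_mul_Ioi hm 0).const_mul _)
  have hI : Integrable (fun x => laplacePDF b x * Real.exp (θ * x)) := by
    rw [← integrableOn_univ, ← Set.Iic_union_Ioi (a := (0 : ℝ))]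
    exact i1.union i2
  have hlt : ∀ᵐ x : ℝ, ENNReal.ofReal (laplacePDF b x) < ⊤ := by simp
  have hto : ∀ x, (ENNReal.ofReal (laplacePDF b x)).toReal = laplacePDF b x := fun x =>
    ENNReal.toReal_ofReal (laplacePDF_nonneg hb x)
  refine ⟨?_, ?_⟩
  · rw [laplaceMeasure, if_pos hb, integrable_withDensity_iff_integrable_smul' (by fun_prop) hlt]
    simpa only [hto, smul_eq_mul] using hI
  · rw [laplaceMeasure, if_pos hb, integral_withDensity_eq_integral_toReal_smul (by fun_prop) hlt]
    simp only [hto, smul_eq_mul]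
    rw [← intervalIntegral.integral_Iic_add_Ioi i1 i2, setIntegral_congr_fun measurableSet_Iic e1,
      setIntegral_congr_fun measurableSet_Ioi e2, integral_const_mul, integral_const_mul,
      integral_exp_mul_Iic hp, integral_exp_mul_Ioi hm]
    simp only [mul_zero, Real.exp_zero]
    have hq : (b * θ) ^ 2 ≤ 1 / 4 := by nlinarith
    have h3 : 1 / (2 * b) * (1 / (1 / b + θ)) + 1 / (2 * b) * (-1 / (θ - 1 / b))
        = 1 / (1 - (b * θ) ^ 2) := by
      have a1 : b * θ + 1 ≠ 0 := by linarith
      have a2 : b * θ - 1 ≠ 0 := by linarith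
      have a3 : 1 - (b * θ) ^ 2 ≠ 0 := by linarith
      have a4 : 1 / b + θ = (b * θ + 1) / b := by field_simp; ring
      have a5 : θ - 1 / b = (b * θ - 1) / b := by field_simp
      rw [a4, a5, div_div_eq_mul_div, div_div_eq_mul_div, div_mul_div_comm, div_mul_div_comm,
        div_add_div _ _ (by simp [hb.ne', a1]) (by simp [hb.ne', a2]),
        div_eq_div_iff (by simp [hb.ne', a1, a2]) a3]
      ring
    rw [h3, div_le_iff₀ (by linarith), ← mul_pow]
    have := Real.add_one_le_exp (2 * (b * θ) ^ 2)
    nlinarith [sq_nonneg (b * θ)]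

/-- The rearrangement inequality for two pairs; the two sides differ by `u * v`, which avoids
subtraction in `ENNReal`. -/
theorem ennreal_mul_add_mul_le {a b c d : ENNReal} (hab : a ≤ b) (hcd : c ≤ d) :
    a * d + b * c ≤ a * c + b * d := by
  obtain ⟨u, rfl⟩ := exists_add_of_le hab
  obtain ⟨v, rfl⟩ := exists_add_of_le hcd
  calc a * (c + v) + (a + u) * c ≤ a * (c + v) + (a + u) * c + u * v := le_self_add
    _ = a * c + (a + u) * (c + v) := by ring

/-- Convolution with a Laplace distribution preserves the functions that are even and
decrease with the distance from the origin. -/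
theorem lintegral_laplaceMeasure_antitone_abs {b : ℝ} (hb : 0 < b) {f : ℝ → ENNReal}
    (hf : Measurable f) (hanti : ∀ x y, |x| ≤ |y| → f y ≤ f x) {x y : ℝ} (hxy : |x| ≤ |y|) :
    ∫⁻ z, f (z + y) ∂laplaceMeasure b ≤ ∫⁻ z, f (z + x) ∂laplaceMeasure b := by
  set p : ℝ → ENNReal := fun z => ENNReal.ofReal (laplacePDF b z) with hp
  have hpm : Measurable p := by fun_prop
  have hpanti : ∀ x y, |x| ≤ |y| → p y ≤ p x := by
    intro x y h
    simp only [hp, laplacePDF]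
    gcongr
  set g : ℝ → ENNReal := fun u => ∫⁻ w, p (w - u) * f w with hg
  have hconv : ∀ u, ∫⁻ z, f (z + u) ∂laplaceMeasure b = g u := by
    intro u
    rw [lintegral_laplaceMeasure hb (f := fun z => f (z + u)) (by fun_prop), hg]
    simp only
    rw [← lintegral_add_right_eq_self (fun w => p (w - u) * f w) u]
    simp [hp]
  have hfe : ∀ u, f (-u) = f u := fun u =>
    le_antisymm (hanti _ _ (by simp)) (hanti _ _ (by simp))
  have hpe : ∀ u, p (-u) = p u := fun u =>
    le_antisymm (hpanti _ _ (by simp)) (hpanti _ _ (by simp))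
  have hge : ∀ u, g |u| = g u := by
    intro u
    rcases abs_choice u with h | h
    · rw [h]
    · rw [h, hg]
      simp only
      rw [← lintegral_neg_eq_self]
      refine lintegral_congr fun w => ?_
      rw [hfe, ← hpe, neg_sub, sub_neg_eq_add, neg_add_eq_sub]
  rw [hconv, hconv, ← hge x, ← hge y]
  have hs := abs_nonneg x
  generalize |x| = s at hxy hs
  generalize |y| = t at hxy
  -- Doubling the integral and folding it by `w ↦ s + t - w` exchanges the roles of `s` and `t` in
  -- the kernel, so that the comparison becomes a pointwise rearrangement.
  have hsym : ∀ u, g u + g u = ∫⁻ w, (p (w - u) * f w + p (s + t - w - u) * f (s + t - w)) := by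
    intro u
    rw [lintegral_add_left (by fun_prop),
      lintegral_sub_left_eq_self (fun w => p (w - u) * f w) (s + t)]
  have hle : g t + g t ≤ g s + g s := by
    rw [hsym, hsym]
    refine lintegral_mono fun w => ?_
    have q1 : p (s + t - w - t) = p (w - s) := by rw [← hpe]; congr 1; ring
    have q2 : p (s + t - w - s) = p (w - t) := by rw [← hpe]; congr 1; ring
    simp only [q1, q2]
    rcases le_total w ((s + t) / 2) with h | h
    · have r1 : p (w - t) ≤ p (w - s) := hpanti _ _ (by
        rw [abs_of_nonpos (show w - t ≤ 0 by linarith), abs_le]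
        constructor <;> linarith)
      have r2 : f (s + t - w) ≤ f w := hanti _ _ (by
        rw [abs_of_nonneg (show 0 ≤ s + t - w by linarith), abs_le]
        constructor <;> linarith)
      exact (ennreal_mul_add_mul_le r1 r2).trans_eq (add_comm _ _)
    · have r1 : p (w - s) ≤ p (w - t) := hpanti _ _ (by
        rw [abs_of_nonneg (show 0 ≤ w - s by linarith), abs_le]
        constructor <;> linarith)
      have r2 : f w ≤ f (s + t - w) := hanti _ _ (by
        rw [abs_of_nonneg (show 0 ≤ w by linarith), abs_le]
        constructor <;> linarith)
      exact (add_comm _ _).trans_le (ennreal_mul_add_mul_le r1 r2)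
  rw [← two_mul, ← two_mul] at hle
  exact (ENNReal.mul_le_mul_iff_right (by simp) (by simp)).1 hle

/-! ### Finitely many coordinates of a product of Laplace measures -/

/-- Resampling one coordinate preserves a product measure. -/
theorem measurePreserving_update_infinitePi {ι : Type*} [DecidableEq ι] (μ : ι → Measure ℝ)
    [∀ i, IsProbabilityMeasure (μ i)] (i : ι) :
    MeasurePreserving (fun p : ℝ × (ι → ℝ) => Function.update p.2 i p.1)
      ((μ i).prod (Measure.infinitePi μ)) (Measure.infinitePi μ) := by
  have hm : Measurable (fun p : ℝ × (ι → ℝ) => Function.update p.2 i p.1) := by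
    refine measurable_pi_lambda _ fun j => ?_
    by_cases h : j = i
    · subst h
      simpa using measurable_fst
    · simp only [Function.update_of_ne h]
      fun_prop
  refine ⟨hm, Measure.eq_infinitePi _ fun s t ht => ?_⟩
  rw [Measure.map_apply hm (.pi s.countable_toSet fun _ _ => ht _)]
  by_cases his : i ∈ s
  · have : (fun p : ℝ × (ι → ℝ) => Function.update p.2 i p.1) ⁻¹' (s : Set ι).pi t
        = t i ×ˢ ((s.erase i : Finset ι) : Set ι).pi t := by
      ext ⟨y, z⟩
      simp only [Set.mem_preimage, Set.mem_pi, Finset.mem_coe, Set.mem_prod, Finset.mem_erase]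
      constructor
      · intro h
        refine ⟨by simpa using h i his, fun j hj => by simpa [hj.1] using h j hj.2⟩
      · rintro ⟨h1, h2⟩ j hj
        by_cases hji : j = i
        · subst hji
          simpa using h1
        · simpa [hji] using h2 j ⟨hji, hj⟩
    rw [this, Measure.prod_prod, Measure.infinitePi_pi _ (fun j _ => ht j),
      Finset.mul_prod_erase s (fun j => μ j (t j)) his]
  · have : (fun p : ℝ × (ι → ℝ) => Function.update p.2 i p.1) ⁻¹' (s : Set ι).pi t
        = Set.univ ×ˢ (s : Set ι).pi t := by
      ext ⟨y, z⟩
      simp only [Set.mem_preimage, Set.mem_pi, Finset.mem_coe, Set.mem_prod, Set.mem_univ,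
        true_and]
      refine forall₂_congr fun j hj => ?_
      rw [Function.update_of_ne (by rintro rfl; exact his hj)]
    rw [this, Measure.prod_prod, Measure.infinitePi_pi _ (fun j _ => ht j), measure_univ, one_mul]

theorem lintegral_infinitePi_update {ι : Type*} [DecidableEq ι] (μ : ι → Measure ℝ)
    [∀ i, IsProbabilityMeasure (μ i)] (i : ι) {f : (ι → ℝ) → ENNReal} (hf : Measurable f) :
    ∫⁻ z, f z ∂Measure.infinitePi μ =
      ∫⁻ z, ∫⁻ y, f (Function.update z i y) ∂μ i ∂Measure.infinitePi μ := by
  have h := measurePreserving_update_infinitePi μ i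
  rw [← h.lintegral_comp hf, lintegral_prod_symm (fun p : ℝ × (ι → ℝ) => f (Function.update p.2 i p.1))
    (hf.comp h.measurable).aemeasurable]

/-- The density bound for a shift of finitely many independent Laplace variables. -/
theorem lintegral_infinitePi_laplace_le_shift {ι : Type*} [DecidableEq ι] {b : ι → ℝ}
    (hb : ∀ i, 0 < b i) (a : ι → ℝ) (F : Finset ι) :
    ∀ f : (ι → ℝ) → ENNReal, Measurable f →
    ∫⁻ z, f z ∂Measure.infinitePi (fun i => laplaceMeasure (b i)) ≤
      ENNReal.ofReal (Real.exp (∑ i ∈ F, |a i| / b i)) *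
        ∫⁻ z, f (z + ∑ i ∈ F, Pi.single i (a i))
          ∂Measure.infinitePi (fun i => laplaceMeasure (b i)) := by
  induction F using Finset.induction_on with
  | empty => intro f hf; simp
  | insert i F hi ih =>
    intro f hf
    refine (ih f hf).trans ?_
    rw [Finset.sum_insert hi, Finset.sum_insert hi, add_comm (|a i| / b i), Real.exp_add,
      ENNReal.ofReal_mul (by positivity), mul_assoc]
    gcongr
    have hg : Measurable fun z : ι → ℝ => f (z + ∑ i ∈ F, Pi.single i (a i)) := by fun_prop
    have hg' : Measurable fun z : ι → ℝ =>
        f (z + (Pi.single i (a i) + ∑ i ∈ F, Pi.single i (a i))) := by fun_prop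
    rw [lintegral_infinitePi_update _ i hg, lintegral_infinitePi_update _ i hg',
      ← lintegral_const_mul' _ _ (by simp)]
    refine lintegral_mono fun z => ?_
    have hu : Measurable fun y : ℝ => Function.update z i y := measurable_update z
    refine (lintegral_laplaceMeasure_le_shift (hb i) (a i) (hg.comp hu)).trans_eq ?_
    congr 1
    refine lintegral_congr fun y => ?_
    simp only [Function.comp]
    congr 1
    rw [← add_assoc]
    congr 1
    funext j
    by_cases h : j = i
    · subst h; simp
    · simp [h]

/-- The sum of independent Laplace variables is symmetric and unimodal. -/
theorem lintegral_sum_laplace_antitone_abs {ι : Type*} [DecidableEq ι] {b : ι → ℝ}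
    (hb : ∀ i, 0 < b i) (F : Finset ι) :
    ∀ f : ℝ → ENNReal, Measurable f → (∀ x y, |x| ≤ |y| → f y ≤ f x) →
    ∀ x y : ℝ, |x| ≤ |y| →
      ∫⁻ z, f (∑ i ∈ F, z i + y) ∂Measure.infinitePi (fun i => laplaceMeasure (b i)) ≤
      ∫⁻ z, f (∑ i ∈ F, z i + x) ∂Measure.infinitePi (fun i => laplaceMeasure (b i)) := by
  induction F using Finset.induction_on with
  | empty => intro f hf h x y hxy; simpa using h x y hxy
  | insert i F hi ih =>
    intro f hf h x y hxy
    -- Integrating out coordinate `i` replaces `f` by its convolution with a Laplace law, again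
    -- decreasing in the absolute value; hence the induction over all such `f`.
    have key : ∀ u : ℝ,
        ∫⁻ z, f (∑ i ∈ insert i F, z i + u) ∂Measure.infinitePi (fun i => laplaceMeasure (b i)) =
        ∫⁻ z, (fun v => ∫⁻ w, f (w + v) ∂laplaceMeasure (b i)) (∑ i ∈ F, z i + u)
          ∂Measure.infinitePi (fun i => laplaceMeasure (b i)) := by
      intro u
      rw [lintegral_infinitePi_update _ i (by fun_prop)]
      refine lintegral_congr fun z => lintegral_congr fun w => ?_
      rw [Finset.sum_insert hi, Function.update_self, add_assoc]
      congr 3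
      refine Finset.sum_congr rfl fun j hj => ?_
      rw [Function.update_of_ne (by rintro rfl; exact hi hj)]
    rw [key, key]
    refine ih (fun v => ∫⁻ w, f (w + v) ∂laplaceMeasure (b i)) ?_ ?_ x y hxy
    · exact Measurable.lintegral_prod_left' (f := fun p : ℝ × ℝ => f (p.1 + p.2)) (by fun_prop)
    · intro x y hxy
      exact lintegral_laplaceMeasure_antitone_abs (hb i) hf h hxy

/-- The noise can be generated from independent variables of law `Lap(1)` by scaling. -/
theorem map_sourceLaw_eq_noiseLaw {lam ε : ℝ} (hb : ∀ l, 0 < noiseScale lam ε l)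
    {e : DyadicInterval → ℕ} (he : Function.Injective e) :
    sourceLaw.map (fun ω I => noiseScale lam ε I.level * ω (e I)) = noiseLaw lam ε := by
  have h1 := Measure.map_infinitePi_infinitePi_of_inj (P := fun _ : ℕ => laplaceMeasure 1) he
  have h2 := Measure.infinitePi_map_pi (fun _ : DyadicInterval => laplaceMeasure 1)
    (f := fun I x => noiseScale lam ε I.level * x) (fun I => by fun_prop)
  rw [← h1, Measure.map_map (by fun_prop) (by fun_prop)] at h2
  simp only [map_mul_laplaceMeasure (hb _)] at h2
  exact h2

/-! ### Dyadic intervals through a point and dyadic covers -/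

theorem mem_dyadicAt {s : ℕ} {I : DyadicInterval} :
    I ∈ dyadicAt s ↔ I.k * 2 ^ I.level ≤ s ∧ s < (I.k + 1) * 2 ^ I.level := by
  have : 0 < (I.k + 1) * 2 ^ I.level := by positivity
  simp only [dyadicAt, Set.Finite.mem_toFinset, Set.mem_ofPred_eq, DyadicInterval.toSet,
    Set.mem_Icc]
  omega

theorem mem_dyadicAt_iff_div {s : ℕ} {I : DyadicInterval} :
    I ∈ dyadicAt s ↔ s / 2 ^ I.level = I.k := by
  rw [mem_dyadicAt, Nat.div_eq_iff (by positivity), add_one_mul]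
  have : 0 < 2 ^ I.level := by positivity
  omega

/-- The dyadic interval of level `l` that contains `s` (if `2 ^ l ≤ s`). -/
def dyadicIntervalAt (l s : ℕ) : DyadicInterval := ⟨l, max 1 (s / 2 ^ l), le_max_left _ _⟩

/-- On each level only `k = s / 2 ^ l` can contain `s`, and `k ≥ 1` holds exactly for `l ≤ log₂ s`.
-/
theorem sum_dyadicAt {M : Type*} [AddCommMonoid M] {s : ℕ} (hs : 1 ≤ s) (f : DyadicInterval → M) :
    ∑ I ∈ dyadicAt s, f I = ∑ l ∈ Finset.range (Nat.log 2 s + 1), f (dyadicIntervalAt l s) := by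
  have hk : ∀ l, l < Nat.log 2 s + 1 → 1 ≤ s / 2 ^ l := fun l hl =>
    (Nat.one_le_div_iff (by positivity)).2 (Nat.pow_le_of_le_log (by omega) (by omega))
  symm
  refine Finset.sum_bij (fun l _ => dyadicIntervalAt l s) ?_ ?_ ?_ (fun _ _ => rfl)
  · intro l hl
    rw [mem_dyadicAt_iff_div]
    exact (max_eq_right (hk l (Finset.mem_range.1 hl))).symm
  · intro l _ l' _ h
    exact congrArg DyadicInterval.level h
  · intro I hI
    rw [mem_dyadicAt_iff_div] at hI
    have h1 := I.k_pos
    rw [← hI, Nat.one_le_div_iff (by positivity)] at h1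
    refine ⟨I.level, Finset.mem_range.2 (Nat.lt_succ_of_le (Nat.le_log_of_pow_le one_lt_two h1)), ?_⟩
    obtain ⟨l, k, hk⟩ := I
    simp only [dyadicIntervalAt, DyadicInterval.mk.injEq, true_and]
    simp only at hI
    omega

/-- Greedy construction from the left: `e` is the end of the part covered so far. If `e` is
divisible by `2 ^ L` but not by `2 ^ (L + 1)`, the level-`L` interval starting at `e` is appended,
which makes the new end divisible; otherwise the level is skipped. The identity of indicators
encodes covering and disjointness at once. -/
theorem exists_dyadic_partition_aux (j : ℕ) (w : ℕ → ℝ) (hw : ∀ l, 0 ≤ w l) (L : ℕ) :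
    ∃ (F : Finset DyadicInterval) (e : ℕ), 2 ^ L ∣ e ∧ j ≤ e ∧ (∀ I ∈ F, I.level < L) ∧
      ∑ I ∈ F, w I.level ≤ ∑ l ∈ Finset.range L, w l ∧
      ∀ s, ∑ I ∈ F, ({s | I ∈ dyadicAt s}).indicator (fun _ => (1 : ℝ)) s =
        ({s | j ≤ s ∧ s < e}).indicator (fun _ => (1 : ℝ)) s := by
  classical
  induction L with
  | zero =>
    refine ⟨∅, j, by simp, le_rfl, by simp, by simp, fun s => ?_⟩
    rw [Set.indicator_of_notMem (by simp)]
    simp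
  | succ L ih =>
    obtain ⟨F, e, he, hje, hF, hsum, hcov⟩ := ih
    by_cases hd : 2 ^ (L + 1) ∣ e
    · refine ⟨F, e, hd, hje, fun I hI => (hF I hI).trans (by omega), ?_, hcov⟩
      rw [Finset.sum_range_succ]
      linarith [hw L]
    · obtain ⟨k, rfl⟩ := he
      have hk : 1 ≤ k := by
        rcases Nat.eq_zero_or_pos k with rfl | h
        · simp at hd
        · exact h
      have hnot : (⟨L, k, hk⟩ : DyadicInterval) ∉ F := fun h => lt_irrefl _ (hF _ h)
      refine ⟨insert ⟨L, k, hk⟩ F, 2 ^ L * (k + 1), ?_, ?_, ?_, ?_, ?_⟩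
      · rw [pow_succ]
        refine Nat.mul_dvd_mul_left _ ?_
        rw [pow_succ, Nat.mul_dvd_mul_iff_left (by positivity)] at hd
        omega
      · refine hje.trans (Nat.mul_le_mul_left _ (by omega))
      · intro I hI
        rcases Finset.mem_insert.1 hI with rfl | h
        · simp
        · exact (hF I h).trans (by omega)
      · rw [Finset.sum_insert hnot, Finset.sum_range_succ]
        linarith
      · intro s
        rw [Finset.sum_insert hnot, hcov]
        simp only [Set.indicator_apply, Set.mem_ofPred_eq, mem_dyadicAt, mul_comm (2 ^ L)]
        have : k * 2 ^ L < (k + 1) * 2 ^ L := by rw [add_one_mul]; simp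
        rw [mul_comm] at hje
        split_ifs <;> first | omega | norm_num

/-- The integers from `j` to `j + n - 1` are covered exactly by disjoint dyadic intervals that
start at or after `j`, with at most one interval of each level `≤ clog₂ n`. -/
theorem exists_dyadic_partition {j n : ℕ} (hj : 1 ≤ j) (w : ℕ → ℝ)
    (hw : ∀ l, 0 ≤ w l) :
    ∃ F : Finset DyadicInterval,
      ∑ I ∈ F, w I.level ≤ ∑ l ∈ Finset.range (Nat.clog 2 n + 1), w l ∧
      ∀ s, s < j + n → ∑ I ∈ F, ({s | I ∈ dyadicAt s}).indicator (fun _ => (1 : ℝ)) s =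
        ({s | j ≤ s}).indicator (fun _ => (1 : ℝ)) s := by
  classical
  obtain ⟨F, e, ⟨k, rfl⟩, hje, hF, hsum, hcov⟩ := exists_dyadic_partition_aux j w hw (Nat.clog 2 n)
  set L := Nat.clog 2 n
  have hk : 1 ≤ k := by
    rcases Nat.eq_zero_or_pos k with rfl | h
    · omega
    · exact h
  -- One more interval, of length `2 ^ L ≥ n`, starting at an end that is at least `j`, reaches
  -- beyond `j + n - 1`.
  have hnot : (⟨L, k, hk⟩ : DyadicInterval) ∉ F := fun h => lt_irrefl _ (hF _ h)
  refine ⟨insert ⟨L, k, hk⟩ F, ?_, ?_⟩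
  · rw [Finset.sum_insert hnot, Finset.sum_range_succ]
    linarith
  · intro s hs
    have hn : n ≤ 2 ^ L := Nat.le_pow_clog one_lt_two n
    rw [Finset.sum_insert hnot, hcov]
    simp only [Set.indicator_apply, Set.mem_ofPred_eq, mem_dyadicAt, add_one_mul, mul_comm (2 ^ L)]
    rw [mul_comm] at hje
    split_ifs <;> first | omega | norm_num

/-! ### The privacy loss of a shift of the noise -/

theorem noiseScale_pos (lam : ℝ) {ε : ℝ} (hε : 0 < ε) (l : ℕ) : 0 < noiseScale lam ε l := by
  unfold noiseScale
  positivity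

/-- The privacy loss is at most the sum of the inverse scales over the levels `≤ clog₂ n`, if the
last `n` prefix sums contain the changed entry. -/
theorem countingMechanism_law_le {lam ε : ℝ} (hε : 0 < ε) (B : ℕ) {τ : ℕ} {S : Set (Fin τ → ℝ)}
    (hS : MeasurableSet S) (x : ℕ → ℝ) {j : ℕ} (hj : 1 ≤ j) {y : ℝ} (hxy : |x j - y| ≤ 1)
    {n : ℕ} (hn : τ < j + n + B) {c : ℝ}
    (hc : ∑ l ∈ Finset.range (Nat.clog 2 n + 1), 1 / noiseScale lam ε l ≤ c) :
    (countingMechanism lam ε B).law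
        {ω | (fun i : Fin τ => (countingMechanism lam ε B).output x (i.val + 1) ω) ∈ S} ≤
      ENNReal.ofReal (Real.exp c) * (countingMechanism lam ε B).law
        {ω | (fun i : Fin τ =>
          (countingMechanism lam ε B).output (Function.update x j y) (i.val + 1) ω) ∈ S} := by
  classical
  have hb := noiseScale_pos lam hε
  obtain ⟨F, hF, hcov⟩ := exists_dyadic_partition (n := n) hj (fun l => 1 / noiseScale lam ε l)
    (fun l => (div_pos one_pos (hb l)).le)
  set v : DyadicInterval → ℝ := ∑ I ∈ F, Pi.single I (y - x j) with hv
  -- Each prefix end `s ≥ j` in range lies in exactly one interval of `F`, and no `s < j` lies in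
  -- any, so the shifted noise compensates exactly for the changed entry.
  have hvs : ∀ s, s < j + n → ∑ I ∈ dyadicAt s, v I = if j ≤ s then y - x j else 0 := by
    intro s hs
    have h := congrArg (· * (y - x j)) (hcov s hs)
    simp only [Finset.sum_mul, Set.indicator_apply, Set.mem_ofPred_eq, ite_mul, one_mul, zero_mul]
      at h
    rw [← h, hv]
    simp only [Finset.sum_apply, Pi.single_apply]
    rw [Finset.sum_comm]
    simp
  have hout : ∀ t, t ≤ τ → ∀ z, (countingMechanism lam ε B).output (Function.update x j y) t z =
      (countingMechanism lam ε B).output x t (z + v) := by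
    intro t ht z
    simp only [countingMechanism]
    split_ifs with h
    · rfl
    · have h2 : ∑ i ∈ Finset.Icc 1 (t - B), Function.update x j y i =
          ∑ i ∈ Finset.Icc 1 (t - B), x i + if j ≤ t - B then y - x j else 0 := by
        have : ∀ i, Function.update x j y i = x i + if i = j then y - x j else 0 := by
          intro i
          by_cases hi : i = j
          · subst hi; simp
          · simp [hi]
        simp only [this, Finset.sum_add_distrib, Finset.sum_ite_eq', Finset.mem_Icc, hj, true_and]
      simp only [Pi.add_apply, Finset.sum_add_distrib, hvs (t - B) (by omega), h2]
      ring
  have hmeas : ∀ x', MeasurableSet {ω | (fun i : Fin τ =>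
      (countingMechanism lam ε B).output x' (i.val + 1) ω) ∈ S} := fun x' =>
    measurableSet_preimage
      (measurable_pi_lambda _ fun i => (countingMechanism lam ε B).measurable_output x' _) hS
  -- The density bound is applied to the indicator of the event for the stream `x`.
  have key := lintegral_infinitePi_laplace_le_shift (b := fun I : DyadicInterval =>
    noiseScale lam ε I.level) (fun I => hb _) (fun _ => y - x j) F _
    (measurable_const.indicator (f := fun _ => (1 : ENNReal)) (hmeas x))
  rw [lintegral_indicator (hmeas x)] at key
  simp only [lintegral_const, Measure.restrict_apply, MeasurableSet.univ, Set.univ_inter,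
    one_mul] at key
  refine key.trans ?_
  gcongr
  · refine le_trans ?_ (hF.trans hc)
    refine Finset.sum_le_sum fun I _ => ?_
    have := hb I.level
    gcongr
    rwa [abs_sub_comm]
  · rw [← lintegral_indicator_one (hmeas _)]
    refine lintegral_mono fun z => ?_
    simp only [Set.indicator_apply, Set.mem_ofPred_eq]
    have : ∀ i : Fin τ, (countingMechanism lam ε B).output (Function.update x j y) (i.val + 1) z =
      (countingMechanism lam ε B).output x (i.val + 1) (z + v) := fun i => hout _ (by omega) z
    simp only [this, Pi.one_apply]
    exact le_rfl

/-! ### Sums of powers -/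

/-- For `a ≥ 0` every term is at most `n ^ a`. For `-1 < a ≤ 0` the sum is compared with the
increments of `n ^ (a + 1) / (a + 1)`. -/
theorem sum_one_add_rpow_le {a : ℝ} (ha : -1 < a) (n : ℕ) :
    ∑ l ∈ Finset.range n, (1 + (l : ℝ)) ^ a ≤ max 1 (1 / (a + 1)) * (n : ℝ) ^ (a + 1) := by
  rcases le_total 0 a with h0 | h0
  · calc ∑ l ∈ Finset.range n, (1 + (l : ℝ)) ^ a ≤ ∑ l ∈ Finset.range n, (n : ℝ) ^ a := by
          refine Finset.sum_le_sum fun l hl => ?_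
          have : (l : ℝ) + 1 ≤ n := by exact_mod_cast Finset.mem_range.1 hl
          exact Real.rpow_le_rpow (by positivity) (by linarith) h0
      _ = 1 * (n : ℝ) ^ (a + 1) := by
          rw [Finset.sum_const, Finset.card_range, nsmul_eq_mul, one_mul,
            Real.rpow_add_one' (by positivity) (by linarith), mul_comm]
      _ ≤ _ := by gcongr; exact le_max_left _ _
  · have hp : 0 < a + 1 := by linarith
    have key : ∑ l ∈ Finset.range n, (1 + (l : ℝ)) ^ a ≤ 1 / (a + 1) * (n : ℝ) ^ (a + 1) := by
      induction n with
      | zero => simp; positivity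
      | succ n ih =>
        rw [Finset.sum_range_succ]
        have hn : (0 : ℝ) < 1 + n := by positivity
        -- Bernoulli's inequality for an exponent in `(0, 1]` bounds `(n / (n + 1)) ^ (a + 1)` by `1
        -- - (a + 1) / (n + 1)`, replacing the comparison with an integral.
        have hb := _root_.rpow_one_add_le_one_add_mul_self (s := -1 / (1 + (n : ℝ)))
          (by rw [le_div_iff₀ hn]; have := Nat.cast_nonneg (α := ℝ) n; linarith) hp.le (by linarith)
        have e1 : 1 + -1 / (1 + (n : ℝ)) = n / (1 + n) := by field_simp; ring
        rw [e1, Real.div_rpow (by positivity) hn.le, div_le_iff₀ (by positivity),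
          Real.rpow_add_one hn.ne'] at hb
        have e2 : (1 + (a + 1) * (-1 / (1 + (n : ℝ)))) * ((1 + n) ^ a * (1 + n))
            = (1 + (n : ℝ)) ^ a * (1 + n) - (a + 1) * (1 + n) ^ a := by field_simp; ring
        rw [e2] at hb
        push_cast
        rw [add_comm (n : ℝ) 1, Real.rpow_add_one hn.ne' a]
        refine (add_le_add_left ih _).trans ?_
        rw [← mul_le_mul_iff_right₀ hp, mul_add, ← mul_assoc, ← mul_assoc, mul_one_div_cancel hp.ne',
          one_mul, one_mul]
        linarith
    refine key.trans ?_
    gcongr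
    exact le_max_right _ _

theorem exists_sum_one_add_rpow_le {a : ℝ} (ha : a < -1) :
    ∃ K : ℝ, 1 ≤ K ∧ ∀ n : ℕ, ∑ l ∈ Finset.range n, (1 + (l : ℝ)) ^ a ≤ K := by
  have hs : Summable fun l : ℕ => (1 + (l : ℝ)) ^ a := by
    have := (summable_nat_add_iff 1).2 (Real.summable_nat_rpow.2 ha)
    simpa [add_comm] using this
  exact ⟨max 1 (∑' l : ℕ, (1 + (l : ℝ)) ^ a), le_max_left _ _, fun n =>
    (hs.sum_le_tsum _ fun l _ => by positivity).trans (le_max_right _ _)⟩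

/-- Used to pass from a power of a number of levels, at most `K (1 + log)`, to `1 + log ^ p`. -/
theorem rpow_le_mul_one_add_rpow {p u y K : ℝ} (hp : 0 ≤ p) (hK : 1 ≤ K) (hu : 0 ≤ u) (hy : 0 ≤ y)
    (h : u ≤ K * (1 + y)) : u ^ p ≤ (2 * K) ^ p * (1 + y ^ p) := by
  have h1 : 1 + y ≤ 2 * max 1 y := by linarith [le_max_left 1 y, le_max_right 1 y]
  calc u ^ p ≤ (2 * K * max 1 y) ^ p := by
        refine Real.rpow_le_rpow hu ?_ hp
        nlinarith
    _ = (2 * K) ^ p * (max 1 y) ^ p := Real.mul_rpow (by positivity) (by positivity)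
    _ ≤ (2 * K) ^ p * (1 + y ^ p) := by
        gcongr
        rcases max_choice 1 y with h | h <;> rw [h]
        · rw [Real.one_rpow]; linarith [Real.rpow_nonneg hy p]
        · linarith

theorem nat_log_le_logb {s t : ℕ} (hs : 1 ≤ s) (hst : s ≤ t) : (Nat.log 2 s : ℝ) ≤ Real.logb 2 t := by
  have h : Nat.log 2 s ≤ Nat.log 2 t := Nat.log_mono_right hst
  refine (Nat.cast_le.2 h).trans ?_
  rw [Real.le_logb_iff_rpow_le (by norm_num) (by exact_mod_cast (by omega : 0 < t)),
    Real.rpow_natCast]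
  exact_mod_cast Nat.pow_log_le_self 2 (by omega)

theorem nat_clog_le_logb_add_one {n : ℕ} (hn : 1 ≤ n) :
    (Nat.clog 2 n : ℝ) ≤ Real.logb 2 n + 1 := by
  rcases Nat.lt_or_ge n 2 with h | h
  · have : n = 1 := by omega
    subst this
    simp
  · have h1 := Nat.pow_pred_clog_lt_self one_lt_two h
    have h2 : 1 ≤ Nat.clog 2 n := Nat.clog_pos one_lt_two h
    have h3 : ((Nat.clog 2 n).pred : ℝ) ≤ Real.logb 2 n := by
      rw [Real.le_logb_iff_rpow_le (by norm_num) (by exact_mod_cast (by omega : 0 < n)),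
        Real.rpow_natCast]
      exact_mod_cast h1.le
    rw [Nat.pred_eq_sub_one] at h3
    push_cast [h2] at h3
    linarith

/-! ### Privacy -/

theorem expirationBound_nonneg {C lam : ℝ} (hC : 0 ≤ C) (B d : ℕ) :
    0 ≤ expirationBound C lam B d := by
  unfold expirationBound
  split_ifs with h
  · exact le_rfl
  · have h1 : (B : ℝ) ≤ d := by exact_mod_cast not_lt.1 h
    have := Real.rpow_nonneg (Real.logb_nonneg one_lt_two
      (show (1 : ℝ) ≤ (d : ℝ) - B + 1 by linarith)) lam
    positivity

/-- The inverse scales are `ε (1 + l) ^ (lam - 1)`, with exponent above `-1`, so their sum over `m`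
levels is of order `ε m ^ lam`. -/
theorem exists_sum_inv_noiseScale_le {lam : ℝ} (hlam : 0 < lam) :
    ∃ C : ℝ, 0 < C ∧ ∀ ε : ℝ, 0 < ε → ∀ n : ℕ, 1 ≤ n →
      ∑ l ∈ Finset.range (Nat.clog 2 n + 1), 1 / noiseScale lam ε l ≤
        C * (1 + Real.logb 2 n ^ lam) * ε := by
  refine ⟨max 1 (1 / (lam - 1 + 1)) * (2 * 2) ^ lam, by positivity, fun ε hε n hn => ?_⟩
  have h1 : ∀ l : ℕ, 1 / noiseScale lam ε l = (1 + (l : ℝ)) ^ (lam - 1) * ε := by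
    intro l
    rw [noiseScale, one_div_div, div_eq_mul_inv, ← Real.rpow_neg (by positivity), neg_sub, mul_comm]
  simp only [h1, ← Finset.sum_mul]
  gcongr
  refine (sum_one_add_rpow_le (by linarith) _).trans ?_
  rw [mul_assoc]
  gcongr
  rw [sub_add_cancel]
  have hl := Real.logb_nonneg one_lt_two (show (1 : ℝ) ≤ n by exact_mod_cast hn)
  refine rpow_le_mul_one_add_rpow hlam.le one_le_two (by positivity) hl ?_
  have := nat_clog_le_logb_add_one hn
  push_cast
  linarith

theorem exists_isDPWithExpiration {lam : ℝ} (hlam : 0 < lam) :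
    ∃ C : ℝ, 0 < C ∧ ∀ C', C ≤ C' → ∀ ε : ℝ, 0 < ε → ∀ (B : ℕ) (D : Set ℝ),
      ∀ f : ℕ → ℝ, Monotone f → (∀ d, expirationBound C' lam B d ≤ f d) →
        IsDPWithExpiration (countingMechanism lam ε B) D ε f := by
  obtain ⟨C, hC, hsum⟩ := exists_sum_inv_noiseScale_le hlam
  refine ⟨C, hC, fun C' hC' ε hε B D f hf hbd => ⟨hf, fun d =>
    (expirationBound_nonneg (hC.le.trans hC') B d).trans (hbd d), ?_⟩⟩
  intro τ hτ S hS x hx j hj hjτ y hy hxy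
  rcases Nat.lt_or_ge (τ - j) B with hd | hd
  -- Within the delay the changed entry has not entered any output, so the two output sequences
  -- coincide.
  · have h0 : 0 ≤ f (τ - j) := (expirationBound_nonneg (hC.le.trans hC') B _).trans (hbd _)
    have heq : ∀ i : Fin τ, (countingMechanism lam ε B).output (Function.update x j y) (i.val + 1)
        = (countingMechanism lam ε B).output x (i.val + 1) := by
      intro i
      funext z
      simp only [countingMechanism]
      split_ifs with h
      · rfl
      · congr 1
        refine Finset.sum_congr rfl fun k hk => ?_
        rw [Finset.mem_Icc] at hk
        exact Function.update_of_ne (by omega) _ _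
    simp only [heq]
    refine le_mul_of_one_le_left zero_le ?_
    rw [ENNReal.one_le_ofReal, Real.one_le_exp_iff]
    positivity
  -- The released prefix sums that contain entry `j` end at `j, …, τ - B`, which is `τ - j - B + 1`
  -- of them.
  · refine countingMechanism_law_le hε B hS x hj hxy (n := τ - j - B + 1) (by omega) ?_
    refine (hsum ε hε _ (by omega)).trans ?_
    gcongr
    refine le_trans ?_ (hbd (τ - j))
    rw [expirationBound, if_neg (by omega)]
    have : ((τ - j - B + 1 : ℕ) : ℝ) = ((τ - j : ℕ) : ℝ) - B + 1 := by
      push_cast [hd]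
      ring
    rw [this]
    have h1 : (B : ℝ) ≤ ((τ - j : ℕ) : ℝ) := by exact_mod_cast hd
    have := Real.rpow_nonneg (Real.logb_nonneg one_lt_two
      (show (1 : ℝ) ≤ ((τ - j : ℕ) : ℝ) - B + 1 by linarith)) lam
    gcongr

/-! ### Sums of independent Laplace variables -/

/-- Moment generating functions multiply by independence, so the exponents of
`integrable_exp_laplaceMeasure` add. -/
theorem integrable_exp_sum_laplace {ι : Type*} {b : ι → ℝ} (hb : ∀ i, 0 < b i) (F : Finset ι)
    {θ : ℝ} (hθ : ∀ i ∈ F, b i * |θ| ≤ 1 / 2) :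
    Integrable (fun z : ι → ℝ => Real.exp (θ * ∑ i ∈ F, z i))
        (Measure.infinitePi fun i => laplaceMeasure (b i)) ∧
      ∫ z : ι → ℝ, Real.exp (θ * ∑ i ∈ F, z i) ∂(Measure.infinitePi fun i => laplaceMeasure (b i))
        ≤ Real.exp (2 * ((∑ i ∈ F, b i ^ 2) * θ ^ 2)) := by
  set μ := Measure.infinitePi fun i => laplaceMeasure (b i) with hμ
  have hind : ProbabilityTheory.iIndepFun (fun (i : ι) (z : ι → ℝ) => z i) μ :=
    ProbabilityTheory.iIndepFun_infinitePi (X := fun _ x => x) (fun _ => measurable_id)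
  have hmeas : ∀ i : ι, Measurable fun z : ι → ℝ => z i := fun i => measurable_pi_apply i
  have hpres := fun i : ι => measurePreserving_eval_infinitePi (fun i => laplaceMeasure (b i)) i
  have hθ' : ∀ i ∈ F, |b i * θ| ≤ 1 / 2 := fun i hi => by
    rw [abs_mul, abs_of_pos (hb i)]
    exact hθ i hi
  have hint : ∀ i ∈ F, Integrable (fun z : ι → ℝ => Real.exp (θ * z i)) μ := fun i hi =>
    (hpres i).integrable_comp_of_integrable (integrable_exp_laplaceMeasure (hb i) (hθ' i hi)).1
  have hsum : ∀ z : ι → ℝ, ∑ i ∈ F, z i = (∑ i ∈ F, fun z : ι → ℝ => z i) z := fun z => by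
    rw [Finset.sum_apply]
  refine ⟨?_, ?_⟩
  · simp only [hsum]
    exact hind.integrable_exp_mul_sum hmeas hint
  · have h := hind.mgf_sum (t := θ) hmeas F
    simp only [ProbabilityTheory.mgf, ← hsum] at h
    rw [h, Finset.sum_mul, Finset.mul_sum, Real.exp_sum]
    refine Finset.prod_le_prod (fun i _ => integral_nonneg fun z => (Real.exp_pos _).le) ?_
    intro i hi
    refine le_trans (le_of_eq ?_) (integrable_exp_laplaceMeasure (hb i) (hθ' i hi)).2
    have := integral_map (μ := μ) (hpres i).measurable.aemeasurable
      (f := fun x => Real.exp (θ * x)) (by fun_prop)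
    rw [(hpres i).map_eq] at this
    exact this.symm

/-- A square is dominated by exponentials: `y ^ 2 ≤ 8 V (exp (θ y) + exp (-θ y))`. Integrability and
the bound then come from the exponential moments; each is at most `exp (1 / 2) ≤ 2`, whence `32 = 8
* 4`. -/
theorem integrable_sq_sum_laplace {ι : Type*} {b : ι → ℝ} (hb : ∀ i, 0 < b i) {F : Finset ι}
    (hF : F.Nonempty) :
    Integrable (fun z : ι → ℝ => (∑ i ∈ F, z i) ^ 2)
        (Measure.infinitePi fun i => laplaceMeasure (b i)) ∧
      ∫ z : ι → ℝ, (∑ i ∈ F, z i) ^ 2 ∂(Measure.infinitePi fun i => laplaceMeasure (b i))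
        ≤ 32 * ∑ i ∈ F, b i ^ 2 := by
  set V := ∑ i ∈ F, b i ^ 2 with hV
  have hVpos : 0 < V := Finset.sum_pos (fun i _ => pow_pos (hb i) 2) hF
  have hsV : 0 < Real.sqrt V := Real.sqrt_pos.2 hVpos
  have hsq : Real.sqrt V ^ 2 = V := Real.sq_sqrt hVpos.le
  -- The largest `θ` that is admissible knowing only `b i ≤ √V`.
  set θ := 1 / (2 * Real.sqrt V) with hθ
  have hθpos : 0 < θ := by positivity
  have hθsq : V * θ ^ 2 = 1 / 4 := by
    rw [hθ, div_pow, mul_pow, hsq]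
    field_simp
    norm_num
  have hle : ∀ i ∈ F, b i * θ ≤ 1 / 2 := by
    intro i hi
    have : b i ≤ Real.sqrt V := Real.le_sqrt_of_sq_le
      (Finset.single_le_sum (f := fun i => b i ^ 2) (fun i _ => sq_nonneg _) hi)
    rw [hθ, mul_one_div, div_le_iff₀ (by positivity)]
    linarith
  obtain ⟨i1, e1⟩ := integrable_exp_sum_laplace hb F (θ := θ) (by rwa [abs_of_pos hθpos])
  obtain ⟨i2, e2⟩ := integrable_exp_sum_laplace hb F (θ := -θ) (by rwa [abs_neg, abs_of_pos hθpos])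
  rw [neg_sq] at e2
  rw [← hV, hθsq] at e1 e2
  have hexp : Real.exp (2 * (1 / 4)) ≤ 2 := by
    have h := Real.exp_one_lt_d9
    have h2 : Real.exp (2 * (1 / 4)) ^ 2 = Real.exp 1 := by rw [← Real.exp_nat_mul]; norm_num
    nlinarith [Real.exp_pos (2 * (1 / 4))]
  have hpt : ∀ y : ℝ, y ^ 2 ≤ 8 * V * (Real.exp (θ * y) + Real.exp (-θ * y)) := by
    intro y
    have h2 : y ^ 2 = 8 * V * ((θ * y) ^ 2 / 2) := by
      rw [mul_pow]
      linear_combination (-4 * y ^ 2) * hθsq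
    rw [h2, neg_mul]
    gcongr
    rcases le_total 0 (θ * y) with h | h
    · linarith [Real.quadratic_le_exp_of_nonneg h, Real.exp_pos (-(θ * y))]
    · have h3 := Real.quadratic_le_exp_of_nonneg (neg_nonneg.2 h)
      rw [neg_sq] at h3
      linarith [Real.exp_pos (θ * y)]
  have hdom := (i1.add i2).const_mul (8 * V)
  have hI : Integrable (fun z : ι → ℝ => (∑ i ∈ F, z i) ^ 2)
        (Measure.infinitePi fun i => laplaceMeasure (b i)) := by
    refine hdom.mono' (Measurable.aestronglyMeasurable (by fun_prop))
      (Filter.Eventually.of_forall fun z => ?_)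
    rw [Real.norm_of_nonneg (sq_nonneg _)]
    exact hpt _
  refine ⟨hI, (integral_mono hI hdom fun z => hpt _).trans ?_⟩
  simp only [Pi.add_apply]
  rw [integral_const_mul, integral_add i1 i2]
  nlinarith

/-- A Bernstein inequality by Chernoff's method on both sides; the factor 2 is their union bound. -/
theorem sum_laplace_tail {ι : Type*} {b : ι → ℝ} (hb : ∀ i, 0 < b i) {F : Finset ι}
    {σ M : ℝ} (hσ : 0 < σ) (hV : ∑ i ∈ F, b i ^ 2 ≤ σ ^ 2) (hM : 0 < M) (hbM : ∀ i ∈ F, b i ≤ M)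
    {δ : ℝ} (hδ : 0 ≤ δ) :
    1 - 2 * Real.exp (-δ) ≤ (Measure.infinitePi fun i => laplaceMeasure (b i)).real
      {z | |∑ i ∈ F, z i| ≤ 3 * σ * Real.sqrt δ + 2 * M * δ} := by
  set μ := Measure.infinitePi fun i => laplaceMeasure (b i) with hμ
  set u := 3 * σ * Real.sqrt δ + 2 * M * δ with hu
  have hs : 0 ≤ Real.sqrt δ := Real.sqrt_nonneg δ
  have hsq : Real.sqrt δ ^ 2 = δ := Real.sq_sqrt hδ
  -- The Gaussian choice `√δ / σ` if it is admissible, where the first term of `u` pays `3 δ`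
  -- against a variance term `2 δ`. Otherwise the maximal `1 / (2 M)`, where the second term of `u`
  -- pays `δ` and the first absorbs the variance term.
  obtain ⟨θ, hθ0, hθM, hθ⟩ : ∃ θ, 0 ≤ θ ∧ M * θ ≤ 1 / 2 ∧ -θ * u + 2 * (σ ^ 2 * θ ^ 2) ≤ -δ := by
    rcases le_total (Real.sqrt δ / σ) (1 / (2 * M)) with h | h
    · refine ⟨Real.sqrt δ / σ, by positivity, ?_, ?_⟩
      · calc M * (Real.sqrt δ / σ) ≤ M * (1 / (2 * M)) := by gcongr
          _ = 1 / 2 := by field_simp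
      · have e1 : Real.sqrt δ / σ * σ = Real.sqrt δ := div_mul_cancel₀ _ hσ.ne'
        have e2 : 0 ≤ Real.sqrt δ / σ * (2 * M * δ) := by positivity
        have e3 : σ ^ 2 * (Real.sqrt δ / σ) ^ 2 = δ := by rw [← mul_pow, mul_comm, e1, hsq]
        have e4 : Real.sqrt δ / σ * (3 * σ * Real.sqrt δ) = 3 * δ := by
          linear_combination 3 * Real.sqrt δ * e1 + 3 * hsq
        rw [e3, hu]
        linarith
    · refine ⟨1 / (2 * M), by positivity, le_of_eq (by field_simp), ?_⟩
      have hle : σ * (1 / (2 * M)) ≤ Real.sqrt δ := by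
        rw [mul_comm]
        exact (le_div_iff₀ hσ).1 h
      have e1 : 1 / (2 * M) * (2 * M * δ) = δ := by field_simp
      have e2 : 0 ≤ σ * (1 / (2 * M)) := by positivity
      rw [hu]
      generalize 1 / (2 * M) = θ at *
      nlinarith
  have hθb : ∀ i ∈ F, b i * θ ≤ 1 / 2 := fun i hi =>
    (mul_le_mul_of_nonneg_right (hbM i hi) hθ0).trans hθM
  obtain ⟨i1, e1⟩ := integrable_exp_sum_laplace hb F (θ := θ) (by rwa [abs_of_nonneg hθ0])
  obtain ⟨i2, e2⟩ := integrable_exp_sum_laplace hb F (θ := -θ)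
    (by rwa [abs_neg, abs_of_nonneg hθ0])
  rw [neg_sq] at e2
  have hexp : Real.exp (-θ * u) * Real.exp (2 * ((∑ i ∈ F, b i ^ 2) * θ ^ 2)) ≤ Real.exp (-δ) := by
    rw [← Real.exp_add, Real.exp_le_exp]
    refine le_trans ?_ hθ
    gcongr
  have t1 := ProbabilityTheory.measure_ge_le_exp_mul_mgf (μ := μ) u hθ0 i1
  have t2 := ProbabilityTheory.measure_le_le_exp_mul_mgf (μ := μ) (-u) (neg_nonpos.2 hθ0) i2
  rw [ProbabilityTheory.mgf] at t1 t2
  have t1' := t1.trans ((mul_le_mul_of_nonneg_left e1 (Real.exp_pos _).le).trans hexp)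
  rw [neg_mul_neg] at t2
  have t2' := t2.trans ((mul_le_mul_of_nonneg_left e2 (Real.exp_pos _).le).trans hexp)
  have hcompl : {z : ι → ℝ | |∑ i ∈ F, z i| ≤ u}ᶜ ⊆
      {z | u ≤ ∑ i ∈ F, z i} ∪ {z | ∑ i ∈ F, z i ≤ -u} := by
    intro z hz
    simp only [Set.mem_compl_iff, Set.mem_ofPred_eq, not_le, lt_abs] at hz
    rcases hz with h | h
    · exact Or.inl h.le
    · exact Or.inr (by simp only [Set.mem_ofPred_eq]; linarith)
  have hm : MeasurableSet {z : ι → ℝ | |∑ i ∈ F, z i| ≤ u} :=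
    measurableSet_le (by fun_prop) measurable_const
  have h1 := (measureReal_mono (μ := μ) hcompl).trans (measureReal_union_le _ _)
  rw [probReal_compl_eq_one_sub hm] at h1
  linarith

/-- Intervals of a given length are likeliest when they are centered at the origin. -/
theorem sum_laplace_interval_le {ι : Type*} {b : ι → ℝ} (hb : ∀ i, 0 < b i) (F : Finset ι)
    (u c : ℝ) :
    (Measure.infinitePi fun i => laplaceMeasure (b i)).real {z | |∑ i ∈ F, z i - c| ≤ u} ≤
      (Measure.infinitePi fun i => laplaceMeasure (b i)).real {z | |∑ i ∈ F, z i| ≤ u} := by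
  classical
  have hm : ∀ c : ℝ, MeasurableSet {z : ι → ℝ | |∑ i ∈ F, z i + c| ≤ u} := fun c =>
    measurableSet_le (by fun_prop) measurable_const
  have hA : MeasurableSet {v : ℝ | |v| ≤ u} := measurableSet_le (by fun_prop) measurable_const
  have h := lintegral_sum_laplace_antitone_abs hb F ({v : ℝ | |v| ≤ u}.indicator 1)
    (measurable_one.indicator hA) (fun x y hxy => by
      simp only [Set.indicator_apply, Set.mem_ofPred_eq]
      split_ifs with h1 h2 <;> first | exact absurd (hxy.trans h1) h2 | simp) 0 (-c) (by simp)
  have e : ∀ c : ℝ, ∫⁻ z : ι → ℝ, ({v : ℝ | |v| ≤ u}.indicator 1 (∑ i ∈ F, z i + c) : ENNReal)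
      ∂(Measure.infinitePi fun i => laplaceMeasure (b i)) =
      (Measure.infinitePi fun i => laplaceMeasure (b i)) {z | |∑ i ∈ F, z i + c| ≤ u} := by
    intro c
    rw [← lintegral_indicator_one (hm c)]
    rfl
  rw [e, e] at h
  simp only [add_zero, ← sub_eq_add_neg] at h
  exact ENNReal.toReal_mono (measure_ne_top _ _) h

/-- `[-T, T]` is covered by `⌈T / u⌉` intervals of length `2 u`, each at most as likely as the
centered one by `sum_laplace_interval_le`. This bounds the mass of a short centered interval from
below. -/
theorem sum_laplace_small_ball {ι : Type*} {b : ι → ℝ} (hb : ∀ i, 0 < b i) (F : Finset ι)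
    {T u : ℝ} (hu : 0 < u) (hT : 0 < T) :
    (Measure.infinitePi fun i => laplaceMeasure (b i)).real {z | |∑ i ∈ F, z i| ≤ T} ≤
      (T / u + 1) *
        (Measure.infinitePi fun i => laplaceMeasure (b i)).real {z | |∑ i ∈ F, z i| ≤ u} := by
  set μ := Measure.infinitePi fun i => laplaceMeasure (b i) with hμ
  set N := ⌈T / u⌉₊ with hN
  have hN0 : 0 < N := Nat.ceil_pos.2 (by positivity)
  have hN1 : T ≤ N * u := (div_le_iff₀ hu).1 (Nat.le_ceil _)
  have hN2 : (N : ℝ) ≤ T / u + 1 := (Nat.ceil_lt_add_one (by positivity)).le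
  have hsub : {z : ι → ℝ | |∑ i ∈ F, z i| ≤ T} ⊆
      ⋃ k ∈ Finset.range N, {z | |∑ i ∈ F, z i - (2 * (k : ℝ) + 1 - N) * u| ≤ u} := by
    intro z hz
    simp only [Set.mem_ofPred_eq] at hz
    obtain ⟨h1, h2⟩ := abs_le.1 hz
    generalize hy : ∑ i ∈ F, z i = y at hz h1 h2
    set r := (y + N * u) / (2 * u) with hr
    have hr0 : 0 ≤ r := div_nonneg (by linarith) (by linarith)
    have hrN : r ≤ N := by
      rw [hr, div_le_iff₀ (by positivity)]
      linarith
    have hry : y = (2 * r - N) * u := by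
      rw [hr]
      field_simp
      ring
    -- At the right end `r = N` the floor is out of range, and the last interval is used.
    have hk : ∃ k : ℕ, k < N ∧ (k : ℝ) ≤ r ∧ r ≤ k + 1 := by
      rcases hrN.lt_or_eq with h | h
      · exact ⟨⌊r⌋₊, (Nat.floor_lt hr0).2 h, Nat.floor_le hr0, (Nat.lt_floor_add_one r).le⟩
      · refine ⟨N - 1, by omega, ?_, ?_⟩ <;> rw [h] <;> push_cast [hN0] <;> linarith
    obtain ⟨k, hkN, hk1, hk2⟩ := hk
    simp only [Set.mem_iUnion, Finset.mem_range, exists_prop]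
    refine ⟨k, hkN, ?_⟩
    simp only [Set.mem_ofPred_eq]
    rw [hy, hry, abs_le]
    constructor <;> nlinarith
  calc μ.real {z | |∑ i ∈ F, z i| ≤ T}
      ≤ μ.real (⋃ k ∈ Finset.range N, {z | |∑ i ∈ F, z i - (2 * (k : ℝ) + 1 - N) * u| ≤ u}) :=
        measureReal_mono hsub (measure_ne_top _ _)
    _ ≤ ∑ k ∈ Finset.range N, μ.real {z | |∑ i ∈ F, z i - (2 * (k : ℝ) + 1 - N) * u| ≤ u} :=
        measureReal_biUnion_finset_le _ _
    _ ≤ ∑ k ∈ Finset.range N, μ.real {z | |∑ i ∈ F, z i| ≤ u} :=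
        Finset.sum_le_sum fun k _ => sum_laplace_interval_le hb F u _
    _ = N * μ.real {z | |∑ i ∈ F, z i| ≤ u} := by simp
    _ ≤ _ := by gcongr

/-- Put `D = log₂ (1 / β)`. For `D ≥ 1` the tail bound with `δ = 2 D` suffices. For `D < 1` the tail
bound gives mass `3 / 4` to the radius `12 (a + m)`, and the small-ball estimate scales this down to
a mass of order `D`, which must exceed `1 - β ≤ D log 2`. The split `a + m` lets the part of the
deviation charged to `m` carry the factor `D` instead of `√D`. -/
theorem sum_laplace_concentration {ι : Type*} {b : ι → ℝ} (hb : ∀ i, 0 < b i) {F : Finset ι}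
    {a m : ℝ} (ha : 0 ≤ a) (hm : 0 < m) (hV : ∑ i ∈ F, b i ^ 2 ≤ (a + m) ^ 2)
    (hbm : ∀ i ∈ F, b i ≤ m) {β : ℝ} (hβ0 : 0 < β) (hβ1 : β < 1) :
    1 - β ≤ (Measure.infinitePi fun i => laplaceMeasure (b i)).real
      {z | |∑ i ∈ F, z i| ≤
        240 * (a * Real.sqrt (Real.logb 2 (1 / β)) + m * Real.logb 2 (1 / β))} := by
  set μ := Measure.infinitePi fun i => laplaceMeasure (b i) with hμ
  set D := Real.logb 2 (1 / β) with hD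
  have hl2 := Real.log_two_lt_d9
  have hl2' : 0 < Real.log 2 := Real.log_pos one_lt_two
  have hDpos : 0 < D := Real.logb_pos one_lt_two (one_lt_one_div hβ0 hβ1)
  have hβD : β = Real.exp (-(D * Real.log 2)) := by
    rw [hD, Real.logb, div_mul_cancel₀ _ hl2'.ne', one_div, Real.log_inv, neg_neg,
      Real.exp_log hβ0]
  have htail := fun {δ : ℝ} (hδ : 0 ≤ δ) =>
    sum_laplace_tail hb (F := F) (σ := a + m) (M := m) (by positivity) hV hm hbm hδ
  have hsD : 0 < Real.sqrt D := Real.sqrt_pos.2 hDpos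
  have hsq : Real.sqrt D ^ 2 = D := Real.sq_sqrt hDpos.le
  rcases le_or_gt 1 D with h1 | h1
  · have hs1 : 1 ≤ Real.sqrt D := Real.one_le_sqrt.2 h1
    have hsle : Real.sqrt D ≤ D := by nlinarith
    refine le_trans ?_ ((htail (δ := 2 * D) (by positivity)).trans (measureReal_mono ?_))
    · have : 2 * Real.exp (-(2 * D)) ≤ β := by
        rw [hβD]
        nth_rewrite 1 [← Real.exp_log two_pos]
        rw [← Real.exp_add, Real.exp_le_exp]
        nlinarith
      linarith
    · intro z hz
      simp only [Set.mem_ofPred_eq] at hz ⊢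
      refine hz.trans ?_
      have hs2 : Real.sqrt (2 * D) ≤ 2 * Real.sqrt D := by
        rw [Real.sqrt_le_left (by positivity), mul_pow, hsq]
        linarith
      calc 3 * (a + m) * Real.sqrt (2 * D) + 2 * m * (2 * D)
          ≤ 3 * (a + m) * (2 * Real.sqrt D) + 2 * m * (2 * D) := by gcongr
        _ ≤ _ := by
          have := mul_nonneg ha hsD.le
          have := mul_le_mul_of_nonneg_left hsle hm.le
          have := mul_pos hm hDpos
          linarith
  · have hs1 : Real.sqrt D ≤ 1 := (Real.sqrt_le_left zero_le_one).2 (by linarith)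
    have hsle : D ≤ Real.sqrt D := by nlinarith
    have ht := htail (δ := 3) (by norm_num)
    have he3 : Real.exp (-3) ≤ 1 / 8 := by
      have h := Real.exp_one_gt_d9
      have h2 : Real.exp (-3) * Real.exp 1 ^ 3 = 1 := by
        rw [← Real.exp_nat_mul, ← Real.exp_add]; norm_num
      have h3 : (8 : ℝ) ≤ Real.exp 1 ^ 3 := by
        calc (8 : ℝ) = 2 ^ 3 := by norm_num
          _ ≤ _ := by gcongr; linarith
      nlinarith [Real.exp_pos (-3)]
    set u := 240 * (a * Real.sqrt D + m * D) with hu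
    have hupos : 0 < u := by positivity
    have hT : {z : ι → ℝ | |∑ i ∈ F, z i| ≤ 3 * (a + m) * Real.sqrt 3 + 2 * m * 3} ⊆
        {z | |∑ i ∈ F, z i| ≤ 12 * (a + m)} := by
      intro z hz
      simp only [Set.mem_ofPred_eq] at hz ⊢
      have h3 : Real.sqrt 3 ≤ 2 := by
        rw [Real.sqrt_le_left (by norm_num)]
        norm_num
      refine hz.trans ?_
      calc 3 * (a + m) * Real.sqrt 3 + 2 * m * 3 ≤ 3 * (a + m) * 2 + 2 * m * 3 := by gcongr
        _ ≤ _ := by linarith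
    have hball := (ht.trans (measureReal_mono hT)).trans
      (sum_laplace_small_ball hb F hupos (show 0 < 12 * (a + m) by positivity))
    -- Since `D ≤ √D`, the radius is at least `240 D (a + m)`. The constant 240 makes the resulting
    -- mass at least `15 D / 21`, and `5 / 7 > log 2`.
    have hratio : 12 * (a + m) / u ≤ 1 / (20 * D) := by
      rw [div_le_div_iff₀ hupos (by positivity), hu]
      nlinarith [mul_le_mul_of_nonneg_left hsle ha]
    have hp : 0 ≤ μ.real {z | |∑ i ∈ F, z i| ≤ u} := measureReal_nonneg
    generalize μ.real {z | |∑ i ∈ F, z i| ≤ u} = p at *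
    have hfin : (3 / 4 : ℝ) ≤ (1 / (20 * D) + 1) * p := by
      have : (12 * (a + m) / u + 1) * p ≤ (1 / (20 * D) + 1) * p := by gcongr
      linarith
    have hβ : 1 - D * Real.log 2 ≤ β := by
      have := Real.add_one_le_exp (-(D * Real.log 2))
      rw [hβD]
      linarith
    have e : 1 / (20 * D) + 1 = (1 + 20 * D) / (20 * D) := by field_simp
    rw [e, div_mul_eq_mul_div, le_div_iff₀ (by positivity)] at hfin
    have hp2 : 15 * D ≤ 21 * p := by nlinarith
    nlinarith

/-! ### The error of the counting algorithm -/

theorem dyadicAt_zero : dyadicAt 0 = ∅ := by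
  refine Finset.eq_empty_of_forall_notMem fun I hI => ?_
  have h := (mem_dyadicAt.1 hI).1
  have := Nat.mul_pos I.k_pos (Nat.two_pow_pos I.level)
  omega

/-- The error is the noise minus the at most `B` latest entries, each in `[0, 1]`. As `dyadicAt 0`
is empty, this includes the steps `t ≤ B`. -/
theorem abs_errorAt_le {lam ε : ℝ} (B : ℕ) {x : ℕ → ℝ} (hx : IsStreamIn (Set.Icc 0 1) x) (t : ℕ)
    (z : DyadicInterval → ℝ) :
    |errorAt lam ε B x t z| ≤ B + |∑ I ∈ dyadicAt (t - B), z I| := by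
  have h1 : errorAt lam ε B x t z =
      ∑ I ∈ dyadicAt (t - B), z I - ∑ i ∈ Finset.Ioc (t - B) t, x i := by
    have hsplit : ∑ i ∈ Finset.Icc 1 t, x i =
        ∑ i ∈ Finset.Icc 1 (t - B), x i + ∑ i ∈ Finset.Ioc (t - B) t, x i := by
      rw [← Finset.sum_union]
      · congr 1
        ext i
        simp only [Finset.mem_Icc, Finset.mem_union, Finset.mem_Ioc]
        omega
      · rw [Finset.disjoint_left]
        intro i
        simp only [Finset.mem_Icc, Finset.mem_Ioc]
        omega
    simp only [errorAt, countingMechanism]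
    split_ifs with h
    · rw [hsplit, Nat.sub_eq_zero_of_le h, dyadicAt_zero]
      simp
    · rw [hsplit]
      ring
  have h2 : |∑ i ∈ Finset.Ioc (t - B) t, x i| ≤ B := by
    have hmem : ∀ i ∈ Finset.Ioc (t - B) t, x i ∈ Set.Icc (0 : ℝ) 1 := fun i hi =>
      hx i (by rw [Finset.mem_Ioc] at hi; omega)
    rw [abs_of_nonneg (Finset.sum_nonneg fun i hi => (hmem i hi).1)]
    refine (Finset.sum_le_sum fun i hi => (hmem i hi).2).trans ?_
    rw [Finset.sum_const, Nat.card_Ioc, nsmul_eq_mul, mul_one]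
    exact_mod_cast (by omega : t - (t - B) ≤ B)
  rw [h1]
  refine (abs_sub _ _).trans ?_
  linarith

theorem sum_sq_noiseScale_dyadicAt {s : ℕ} (hs : 1 ≤ s) (lam ε : ℝ) :
    ∑ I ∈ dyadicAt s, noiseScale lam ε I.level ^ 2 =
      (∑ l ∈ Finset.range (Nat.log 2 s + 1), (1 + (l : ℝ)) ^ (2 - 2 * lam)) / ε ^ 2 := by
  rw [sum_dyadicAt hs, Finset.sum_div]
  refine Finset.sum_congr rfl fun l _ => ?_
  simp only [dyadicIntervalAt, noiseScale, div_pow]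
  rw [← Real.rpow_natCast, ← Real.rpow_mul (by positivity)]
  congr 2
  push_cast
  ring

/-- The condition `lam ≠ 3 / 2` excludes the exponent `-1`, where the sum would grow
logarithmically: below it is a power, above it converges. -/
theorem exists_sum_rpow_le {lam : ℝ} (hlam : lam ≠ 3 / 2) :
    ∃ K : ℝ, 1 ≤ K ∧ ∀ n : ℕ, 1 ≤ n →
      ∑ l ∈ Finset.range n, (1 + (l : ℝ)) ^ (2 - 2 * lam) ≤ K * (n : ℝ) ^ max 0 (3 - 2 * lam) := by
  rcases lt_or_gt_of_ne hlam with h | h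
  · refine ⟨max 1 (1 / (2 - 2 * lam + 1)), le_max_left _ _, fun n hn => ?_⟩
    rw [max_eq_right (show (0 : ℝ) ≤ 3 - 2 * lam by linarith),
      show 3 - 2 * lam = 2 - 2 * lam + 1 by ring]
    exact sum_one_add_rpow_le (a := 2 - 2 * lam) (by linarith) n
  · obtain ⟨K, hK, hsum⟩ := exists_sum_one_add_rpow_le (a := 2 - 2 * lam) (by linarith)
    refine ⟨K, hK, fun n hn => ?_⟩
    rw [max_eq_left (by linarith), Real.rpow_zero, mul_one]
    exact hsum n

theorem exists_sum_sq_noiseScale_le {lam : ℝ} (hlam : lam ≠ 3 / 2) :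
    ∃ K : ℝ, 0 < K ∧ ∀ (ε : ℝ) (s t : ℕ), 0 < ε → 1 ≤ t → s ≤ t →
      ∑ I ∈ dyadicAt s, noiseScale lam ε I.level ^ 2 ≤
        K * ((1 + Real.logb 2 t ^ (3 - 2 * lam)) / ε ^ 2) := by
  obtain ⟨K, hK, hsum⟩ := exists_sum_rpow_le hlam
  refine ⟨K * (2 * 1) ^ max 0 (3 - 2 * lam), by positivity, fun ε s t hε ht hst => ?_⟩
  have hl := Real.logb_nonneg one_lt_two (show (1 : ℝ) ≤ t by exact_mod_cast ht)
  have hpow := Real.rpow_nonneg hl (3 - 2 * lam)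
  rcases Nat.eq_zero_or_pos s with rfl | hs
  · rw [dyadicAt_zero, Finset.sum_empty]
    positivity
  · rw [sum_sq_noiseScale_dyadicAt hs, ← mul_div_assoc]
    gcongr
    refine (hsum _ (by omega)).trans ?_
    rw [mul_assoc]
    gcongr
    rcases le_total (3 - 2 * lam) 0 with h | h
    · rw [max_eq_left h, Real.rpow_zero, Real.rpow_zero]
      linarith
    · rw [max_eq_right h]
      refine rpow_le_mul_one_add_rpow h le_rfl (by positivity) hl ?_
      have := nat_log_le_logb hs hst
      push_cast
      linarith

/-- A bound on the deviation scale with the exponent `q` of the theorem: `max 0 (3 - 2 lam) ≤ 2 q`,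
and `K ≤ K ^ 2` because `K ≥ 1`. -/
theorem exists_sum_sq_noiseScale_le_sq {lam : ℝ} (hlam : lam ≠ 3 / 2) :
    ∃ K : ℝ, 0 < K ∧ ∀ (ε : ℝ) (s t : ℕ), 0 < ε → 1 ≤ t → s ≤ t →
      ∑ I ∈ dyadicAt s, noiseScale lam ε I.level ^ 2 ≤
        (K * (1 + Real.logb 2 t ^ max (1 / 2) (3 / 2 - lam)) / ε) ^ 2 := by
  obtain ⟨K, hK, hsum⟩ := exists_sum_rpow_le hlam
  set q := max (1 / 2) (3 / 2 - lam) with hq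
  have hq0 : 0 ≤ q := (by norm_num : (0 : ℝ) ≤ 1 / 2).trans (le_max_left _ _)
  refine ⟨K * (2 * 1) ^ q, by positivity, fun ε s t hε ht hst => ?_⟩
  have hl := Real.logb_nonneg one_lt_two (show (1 : ℝ) ≤ t by exact_mod_cast ht)
  rcases Nat.eq_zero_or_pos s with rfl | hs
  · rw [dyadicAt_zero, Finset.sum_empty]
    positivity
  · rw [sum_sq_noiseScale_dyadicAt hs, div_pow]
    gcongr
    refine (hsum _ (by omega)).trans ?_
    have h1 : ((Nat.log 2 s + 1 : ℕ) : ℝ) ^ q ≤ (2 * 1) ^ q * (1 + Real.logb 2 t ^ q) := by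
      refine rpow_le_mul_one_add_rpow hq0 le_rfl (by positivity) hl ?_
      have := nat_log_le_logb hs hst
      push_cast
      linarith
    have hn : (1 : ℝ) ≤ ((Nat.log 2 s + 1 : ℕ) : ℝ) := by exact_mod_cast (by omega)
    calc K * ((Nat.log 2 s + 1 : ℕ) : ℝ) ^ max 0 (3 - 2 * lam)
        ≤ K ^ 2 * (((Nat.log 2 s + 1 : ℕ) : ℝ) ^ q) ^ 2 := by
          rw [← Real.rpow_natCast (_ ^ q), ← Real.rpow_mul (by positivity)]
          gcongr
          · nlinarith
          · refine max_le (by positivity) ?_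
            have := le_max_right (1 / 2) (3 / 2 - lam)
            push_cast
            linarith
      _ = (K * ((Nat.log 2 s + 1 : ℕ) : ℝ) ^ q) ^ 2 := by ring
      _ ≤ _ := by
          rw [mul_assoc]
          gcongr

theorem exists_noiseScale_le (lam : ℝ) :
    ∃ K : ℝ, 0 < K ∧ ∀ (ε : ℝ) (s t : ℕ), 0 < ε → 1 ≤ t → s ≤ t → ∀ I ∈ dyadicAt s,
      noiseScale lam ε I.level ≤ K * (1 + Real.logb 2 t ^ (1 - lam)) / ε := by
  refine ⟨(2 * 1) ^ max 0 (1 - lam), by positivity, fun ε s t hε ht hst I hI => ?_⟩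
  have hl := Real.logb_nonneg one_lt_two (show (1 : ℝ) ≤ t by exact_mod_cast ht)
  have hpow := Real.rpow_nonneg hl (1 - lam)
  unfold noiseScale
  gcongr
  rcases le_total (1 - lam) 0 with h | h
  · rw [max_eq_left h, Real.rpow_zero]
    have := Real.rpow_le_one_of_one_le_of_nonpos (x := 1 + (I.level : ℝ)) (by simp) h
    linarith
  · rw [max_eq_right h]
    refine rpow_le_mul_one_add_rpow h le_rfl (by positivity) hl ?_
    have h1 := (mem_dyadicAt.1 hI).1
    have hs : 2 ^ I.level ≤ s := (Nat.le_mul_of_pos_left _ I.k_pos).trans h1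
    have h2 : I.level ≤ Nat.log 2 s := Nat.le_log_of_pow_le one_lt_two hs
    have h3 := nat_log_le_logb ((Nat.one_le_two_pow).trans hs) hst
    have h4 : (I.level : ℝ) ≤ Nat.log 2 s := by exact_mod_cast h2
    linarith

theorem exists_integral_sq_errorAt_le {lam : ℝ} (hlam : lam ≠ 3 / 2) :
    ∃ C : ℝ, 0 < C ∧ ∀ ε : ℝ, 0 < ε → ∀ (B : ℕ) (x : ℕ → ℝ), IsStreamIn (Set.Icc 0 1) x →
      ∀ t : ℕ, 1 ≤ t →
        Integrable (fun z => errorAt lam ε B x t z ^ 2) (countingMechanism lam ε B).law ∧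
        ∫ z, errorAt lam ε B x t z ^ 2 ∂(countingMechanism lam ε B).law ≤
          C * ((B : ℝ) ^ 2 + (1 + Real.logb 2 t ^ (3 - 2 * lam)) / ε ^ 2) := by
  obtain ⟨K, hK, hsum⟩ := exists_sum_sq_noiseScale_le hlam
  refine ⟨2 + 64 * K, by positivity, fun ε hε B x hx t ht => ?_⟩
  have hb := fun I : DyadicInterval => noiseScale_pos lam hε I.level
  have hY : Integrable (fun z : DyadicInterval → ℝ => (∑ I ∈ dyadicAt (t - B), z I) ^ 2)
        (countingMechanism lam ε B).law ∧
      ∫ z : DyadicInterval → ℝ, (∑ I ∈ dyadicAt (t - B), z I) ^ 2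
        ∂(countingMechanism lam ε B).law
        ≤ 32 * ∑ I ∈ dyadicAt (t - B), noiseScale lam ε I.level ^ 2 := by
    rcases (dyadicAt (t - B)).eq_empty_or_nonempty with h | h
    · simp [h]
    · exact integrable_sq_sum_laplace hb h
  have := (countingMechanism lam ε B).isProbabilityMeasure_law
  have hdom := (integrable_const (μ := (countingMechanism lam ε B).law) (2 * (B : ℝ) ^ 2)).add
    (hY.1.const_mul 2)
  have hpt : ∀ z, errorAt lam ε B x t z ^ 2 ≤
      2 * (B : ℝ) ^ 2 + 2 * (∑ I ∈ dyadicAt (t - B), z I) ^ 2 := by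
    intro z
    rw [← sq_abs, ← sq_abs (∑ I ∈ _, _)]
    have h := abs_errorAt_le (lam := lam) (ε := ε) B hx t z
    have h0 := abs_nonneg (errorAt lam ε B x t z)
    nlinarith [sq_nonneg ((B : ℝ) - |∑ I ∈ dyadicAt (t - B), z I|)]
  have hI : Integrable (fun z => errorAt lam ε B x t z ^ 2) (countingMechanism lam ε B).law := by
    refine hdom.mono' (Measurable.aestronglyMeasurable ?_) (Filter.Eventually.of_forall fun z => ?_)
    · exact (((countingMechanism lam ε B).measurable_output x t).sub_const _).pow_const 2
    · rw [Real.norm_of_nonneg (sq_nonneg _)]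
      exact hpt z
  refine ⟨hI, (integral_mono hI hdom hpt).trans ?_⟩
  simp only [Pi.add_apply]
  rw [integral_add (integrable_const _) (hY.1.const_mul 2), integral_const, integral_const_mul,
    probReal_univ, one_smul]
  have h1 := hsum ε (t - B) t hε ht (by omega)
  have hl := Real.logb_nonneg one_lt_two (show (1 : ℝ) ≤ t by exact_mod_cast ht)
  have hpow := Real.rpow_nonneg hl (3 - 2 * lam)
  have h2 : 0 ≤ (1 + Real.logb 2 t ^ (3 - 2 * lam)) / ε ^ 2 := by positivity
  have h3 : 0 ≤ K * (B : ℝ) ^ 2 := by positivity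
  nlinarith [hY.2]

theorem exists_errorAt_concentration {lam : ℝ} (hlam : lam ≠ 3 / 2) :
    ∃ C : ℝ, 0 < C ∧ ∀ C', C ≤ C' → ∀ ε : ℝ, 0 < ε → ∀ (B : ℕ) (x : ℕ → ℝ),
      IsStreamIn (Set.Icc 0 1) x → ∀ t : ℕ, 1 ≤ t → ∀ β : ℝ, 0 < β → β < 1 →
        1 - β ≤ (countingMechanism lam ε B).law.real {z | |errorAt lam ε B x t z| ≤
          C' * (B + (Real.logb 2 t ^ max (1 / 2) (3 / 2 - lam) * Real.sqrt (Real.logb 2 (1 / β))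
            + (1 + Real.logb 2 t ^ (1 - lam)) * Real.logb 2 (1 / β)) / ε)} := by
  obtain ⟨K₁, hK₁, hV⟩ := exists_sum_sq_noiseScale_le_sq hlam
  obtain ⟨K₂, hK₂, hM⟩ := exists_noiseScale_le lam
  refine ⟨1 + 240 * (K₁ + K₂), by positivity, fun C' hC' ε hε B x hx t ht β hβ0 hβ1 => ?_⟩
  have hl := Real.logb_nonneg one_lt_two (show (1 : ℝ) ≤ t by exact_mod_cast ht)
  have hDpos : 0 < Real.logb 2 (1 / β) := Real.logb_pos one_lt_two (one_lt_one_div hβ0 hβ1)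
  have := (countingMechanism lam ε B).isProbabilityMeasure_law
  set P := Real.logb 2 t ^ max (1 / 2) (3 / 2 - lam) with hP
  set R := Real.logb 2 t ^ (1 - lam) with hR
  set D := Real.logb 2 (1 / β) with hD
  have hP0 : 0 ≤ P := Real.rpow_nonneg hl _
  have hR0 : 0 ≤ R := Real.rpow_nonneg hl _
  -- The deviation bound `K₁ (1 + P) / ε` is split: `P` goes to `a` and the constant 1 to `m`. Hence
  -- no additive constant accompanies `log ^ q t` in front of the square root.
  have hc := sum_laplace_concentration (fun I : DyadicInterval => noiseScale_pos lam hε I.level)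
    (F := dyadicAt (t - B)) (a := (K₁ + K₂) * P / ε) (m := (K₁ + K₂) * (1 + R) / ε)
    (by positivity) (by positivity)
    ((hV ε (t - B) t hε ht (by omega)).trans (by
      rw [← add_div]
      gcongr
      nlinarith [mul_nonneg hK₂.le hP0, mul_nonneg hK₁.le hR0, mul_nonneg hK₂.le hR0]))
    (fun I hI => (hM ε (t - B) t hε ht (by omega) I hI).trans (by gcongr; linarith)) hβ0 hβ1
  refine hc.trans (measureReal_mono (fun z hz => ?_) (measure_ne_top _ _))
  simp only [Set.mem_ofPred_eq] at hz ⊢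
  refine (abs_errorAt_le B hx t z).trans ((add_le_add_right hz _).trans ?_)
  set Q := (P * Real.sqrt D + (1 + R) * D) / ε with hQ
  have hQ0 : 0 ≤ Q := by positivity
  have e : 240 * ((K₁ + K₂) * P / ε * Real.sqrt D + (K₁ + K₂) * (1 + R) / ε * D)
      = 240 * (K₁ + K₂) * Q := by rw [hQ]; ring
  rw [← hD, e]
  have hB : (0 : ℝ) ≤ B := Nat.cast_nonneg B
  have h1 : (1 + 240 * (K₁ + K₂)) * (B + Q) ≤ C' * (B + Q) := by gcongr
  have h2 : 0 ≤ 240 * (K₁ + K₂) * (B : ℝ) := by positivity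
  nlinarith

theorem exists_errorAt_concentration_of_rpow_le {lam : ℝ} (hlam : lam ≠ 3 / 2) {c : ℝ}
    (hc : 0 < c) :
    ∃ C : ℝ, 0 < C ∧ ∀ ε : ℝ, 0 < ε → ∀ (B : ℕ) (x : ℕ → ℝ),
      IsStreamIn (Set.Icc 0 1) x → ∀ t : ℕ, 1 ≤ t → ∀ β : ℝ, 0 < β → β < 1 → (t : ℝ) ^ (-c) ≤ β →
        1 - β ≤ (countingMechanism lam ε B).law.real {z | |errorAt lam ε B x t z| ≤
          C * (B + Real.logb 2 t ^ max (1 / 2) (3 / 2 - lam) * Real.sqrt (Real.logb 2 (1 / β))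
            / ε)} := by
  obtain ⟨C, hC, hconc⟩ := exists_errorAt_concentration hlam
  refine ⟨C * (1 + 2 * Real.sqrt c), by positivity, fun ε hε B x hx t ht β hβ0 hβ1 htβ => ?_⟩
  have := (countingMechanism lam ε B).isProbabilityMeasure_law
  refine (hconc C le_rfl ε hε B x hx t ht β hβ0 hβ1).trans
    (measureReal_mono (fun z hz => ?_) (measure_ne_top _ _))
  simp only [Set.mem_ofPred_eq] at hz ⊢
  refine hz.trans ?_
  -- For `t = 1` the condition on `β` would force `β ≥ 1`; so `log₂ t ≥ 1`, and its powers are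
  -- monotone in the exponent.
  have ht2 : (2 : ℝ) ≤ t := by
    have : t ≠ 1 := by
      rintro rfl
      simp only [Nat.cast_one, Real.one_rpow] at htβ
      linarith
    exact_mod_cast (by omega : 2 ≤ t)
  have ht0 : (0 : ℝ) < t := by linarith
  have hl : 1 ≤ Real.logb 2 t := by
    rw [Real.le_logb_iff_rpow_le one_lt_two ht0, Real.rpow_one]
    exact ht2
  have hDpos : 0 < Real.logb 2 (1 / β) := Real.logb_pos one_lt_two (one_lt_one_div hβ0 hβ1)
  have hDle : Real.logb 2 (1 / β) ≤ c * Real.logb 2 t := by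
    rw [← Real.logb_rpow_eq_mul_logb_of_pos ht0]
    refine Real.logb_le_logb_of_le one_lt_two (by positivity) ?_
    rw [Real.rpow_neg ht0.le] at htβ
    rw [one_div]
    exact inv_le_of_inv_le₀ (by positivity) htβ
  set ℓ := Real.logb 2 t with hℓ
  set D := Real.logb 2 (1 / β) with hD
  set q := max (1 / 2) (3 / 2 - lam) with hq
  have hsD : Real.sqrt D ≤ Real.sqrt c * ℓ ^ (1 / 2 : ℝ) := by
    rw [← Real.sqrt_eq_rpow, ← Real.sqrt_mul hc.le]
    exact Real.sqrt_le_sqrt hDle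
  -- Trading one factor `√D` for `√c ℓ ^ (1 / 2)` turns the linear term into the square-root term;
  -- the two resulting exponents are exactly those in the maximum `q`.
  have hmul : (1 + ℓ ^ (1 - lam)) * ℓ ^ (1 / 2 : ℝ) ≤ 2 * ℓ ^ q := by
    rw [add_mul, one_mul, ← Real.rpow_add (by linarith)]
    have h1 : ℓ ^ (1 / 2 : ℝ) ≤ ℓ ^ q := Real.rpow_le_rpow_of_exponent_le hl (le_max_left _ _)
    have h2 : ℓ ^ (1 - lam + 1 / 2) ≤ ℓ ^ q := Real.rpow_le_rpow_of_exponent_le hl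
      (by rw [show 1 - lam + 1 / 2 = 3 / 2 - lam by ring]; exact le_max_right _ _)
    linarith
  have hs0 := Real.sqrt_nonneg D
  have hkey : (1 + ℓ ^ (1 - lam)) * D ≤ 2 * Real.sqrt c * (ℓ ^ q * Real.sqrt D) := by
    calc (1 + ℓ ^ (1 - lam)) * D = (1 + ℓ ^ (1 - lam)) * Real.sqrt D * Real.sqrt D := by
          rw [mul_assoc, Real.mul_self_sqrt hDpos.le]
      _ ≤ (1 + ℓ ^ (1 - lam)) * (Real.sqrt c * ℓ ^ (1 / 2 : ℝ)) * Real.sqrt D := by gcongr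
      _ = Real.sqrt c * ((1 + ℓ ^ (1 - lam)) * ℓ ^ (1 / 2 : ℝ)) * Real.sqrt D := by ring
      _ ≤ Real.sqrt c * (2 * ℓ ^ q) * Real.sqrt D := by gcongr
      _ = _ := by ring
  rw [mul_assoc C]
  gcongr
  have hB : 0 ≤ 2 * Real.sqrt c * (B : ℝ) := by positivity
  have h1 : (ℓ ^ q * Real.sqrt D + (1 + ℓ ^ (1 - lam)) * D) / ε ≤
      (1 + 2 * Real.sqrt c) * (ℓ ^ q * Real.sqrt D / ε) := by
    rw [← mul_div_assoc]
    gcongr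
    linarith
  linarith

/-! ### The program -/

/-- The program of the counting algorithm.  In the natural-number memory, cell 1 holds `B + 9`,
cell 2 counts the first `B` steps, cell 3 is the pointer of the circular buffer (the real cells
`8, …, B + 8`) of the last `B + 1` stream entries, and the cells from `B + 9` on are the bits of a
counter.  In the real memory, cell 2 holds the next output, cell 4 holds `1 - lam`, and the cells
from `B + 9` on hold the current noise variables of the levels `0, 1, …`. -/
def countingProgram : Program := [
  .copy (.direct 1) (.direct 0),
  .incr (.direct 1), .incr (.direct 1), .incr (.direct 1),
  .incr (.direct 1), .incr (.direct 1), .incr (.direct 1),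
  .incr (.direct 1), .incr (.direct 1), .incr (.direct 1),
  .const (.direct 3) 8,
  .const (.direct 6) 1,
  .cast (.direct 4) (.direct 6),
  .arith .sub (.direct 4) (.direct 4) (.direct 0),
  -- Address 14, the main loop: the new entry overwrites the oldest one, and the advanced pointer
  -- then designates the entry `B` steps back, which is added to the output. A cell compared with
  -- itself gives an unconditional jump.
  .input (.indirect 3),
  .incr (.direct 3),
  .jumpEq (.direct 3) (.direct 1) 21,
  .arith .add (.direct 2) (.direct 2) (.indirect 3),
  .jumpEq (.direct 2) (.direct 0) 23,
  .incr (.direct 2),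
  .jumpEq (.direct 7) (.direct 7) 38,
  .const (.direct 3) 8,
  .jumpEq (.direct 7) (.direct 7) 17,
  -- Address 23, the counter increment: every visited level gets fresh noise; bits 1 are cleared and
  -- the carry moves on, and the first bit 0 is set and ends the loop. Cell 5 holds the level plus
  -- one, the base of the scale.
  .copy (.direct 4) (.direct 1),
  .const (.direct 5) 1,
  .cast (.direct 3) (.direct 5),
  .arith .pow (.direct 3) (.direct 3) (.direct 4),
  .arith .div (.direct 3) (.direct 3) (.direct 1),
  .laplace (.direct 3) (.direct 3),
  .arith .sub (.direct 2) (.direct 2) (.indirect 4),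
  .move (.indirect 4) (.direct 3),
  .arith .add (.direct 2) (.direct 2) (.direct 3),
  .jumpEq (.indirect 4) (.direct 7) 37,
  .const (.indirect 4) 0,
  .incr (.direct 4),
  .incr (.direct 5),
  .jumpEq (.direct 7) (.direct 7) 25,
  .const (.indirect 4) 1,
  .output (.direct 2),
  .jumpEq (.direct 7) (.direct 7) 14]

/-! ### Runs that access a bounded part of the memory -/

/-- The cells with addresses below `N`. -/
def cellsBelow (N : ℕ) : Finset (ℕ ⊕ ℕ) := (Finset.range N).disjSum (Finset.range N)

theorem card_cellsBelow (N : ℕ) : (cellsBelow N).card = 2 * N := by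
  rw [cellsBelow, Finset.card_disjSum, Finset.card_range, two_mul]

@[simp]
theorem inl_mem_cellsBelow {N n : ℕ} : Sum.inl n ∈ cellsBelow N ↔ n < N := by
  simp [cellsBelow]

@[simp]
theorem inr_mem_cellsBelow {N n : ℕ} : Sum.inr n ∈ cellsBelow N ↔ n < N := by
  simp [cellsBelow]

/-- The cells accessed in the next step of a program. -/
def Program.cellsAt (P : Program) (σ : State) : Finset (ℕ ⊕ ℕ) :=
  match P[σ.pc]? with
  | some i => i.cells σ
  | none => ∅

/-- In `n` steps the program gets from `σ` to `σ'`, accessing only cells below `N`. -/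
def Program.Reaches (P : Program) (x ω : ℕ → ℝ) (N n : ℕ) (σ σ' : State) : Prop :=
  (P.step x ω)^[n] σ = σ' ∧ ∀ m < n, P.cellsAt ((P.step x ω)^[m] σ) ⊆ cellsBelow N

theorem Program.Reaches.refl (P : Program) (x ω : ℕ → ℝ) (N : ℕ) (σ : State) :
    P.Reaches x ω N 0 σ σ := ⟨rfl, by simp⟩

theorem Program.Reaches.head {P : Program} {x ω : ℕ → ℝ} {N n : ℕ} {σ σ' : State} {i : Instr}
    (hi : P[σ.pc]? = some i) (hc : i.cells σ ⊆ cellsBelow N)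
    (h : P.Reaches x ω N n (i.exec x ω σ) σ') : P.Reaches x ω N (n + 1) σ σ' := by
  have hstep : P.step x ω σ = i.exec x ω σ := by simp [Program.step, hi]
  refine ⟨by rw [Function.iterate_succ_apply, hstep, h.1], fun m hm => ?_⟩
  rcases m with _ | m
  · simpa [Program.cellsAt, hi] using hc
  · rw [Function.iterate_succ_apply, hstep]
    exact h.2 m (by omega)

theorem Program.exists_reaches_zero {P : Program} {x ω : ℕ → ℝ} {N : ℕ} {σ : State}
    {Q : State → Prop} (h : Q σ) : ∃ σ', P.Reaches x ω N 0 σ σ' ∧ Q σ' :=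
  ⟨σ, Program.Reaches.refl P x ω N σ, h⟩

/-- The existential form allows symbolic execution, one instruction at a time, without naming the
final state. -/
theorem Program.exists_reaches_succ {P : Program} {x ω : ℕ → ℝ} {N n : ℕ} {σ : State} {i : Instr}
    {Q : State → Prop} (hi : P[σ.pc]? = some i) (hc : i.cells σ ⊆ cellsBelow N)
    (h : ∃ σ', P.Reaches x ω N n (i.exec x ω σ) σ' ∧ Q σ') :
    ∃ σ', P.Reaches x ω N (n + 1) σ σ' ∧ Q σ' := by
  obtain ⟨σ', h1, h2⟩ := h
  exact ⟨σ', h1.head hi hc, h2⟩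

theorem Program.Reaches.trans {P : Program} {x ω : ℕ → ℝ} {N n m : ℕ} {σ σ' σ'' : State}
    (h : P.Reaches x ω N n σ σ') (h' : P.Reaches x ω N m σ' σ'') :
    P.Reaches x ω N (n + m) σ σ'' := by
  refine ⟨by rw [add_comm, Function.iterate_add_apply, h.1, h'.1], fun k hk => ?_⟩
  rcases Nat.lt_or_ge k n with hkn | hkn
  · exact h.2 k hkn
  · obtain ⟨j, rfl⟩ := Nat.exists_eq_add_of_le hkn
    rw [add_comm, Function.iterate_add_apply, h.1]
    exact h'.2 j (by omega)

/-- The contents of the memory cells at the main points of the program, after `t` entries have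
been read. -/
structure Config (lam ε : ℝ) (B : ℕ) (x : ℕ → ℝ) (pc t em cnt dr : ℕ) (acc : ℝ) (bit : ℕ → ℕ)
    (leaf : ℕ → ℝ) (σ : State) : Prop where
  pc_eq : σ.pc = pc
  nat_zero : σ.nat 0 = B
  nat_one : σ.nat 1 = B + 9
  nat_two : σ.nat 2 = cnt
  nat_three : σ.nat 3 = t % (B + 1) + 8
  nat_seven : σ.nat 7 = 0
  nat_bit : ∀ i, σ.nat (B + i + 9) = bit i
  real_zero : σ.real 0 = lam
  real_one : σ.real 1 = ε
  real_two : σ.real 2 = acc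
  real_four : σ.real 4 = 1 - lam
  real_fresh : ∀ i, t ≤ i → i ≤ B → σ.real (i + 8) = 0
  real_buffer : ∀ u, u < t → t ≤ u + (B + 1) → σ.real (u % (B + 1) + 8) = x (u + 1)
  real_leaf : ∀ i, σ.real (B + i + 9) = leaf i
  drawn_eq : σ.drawn = dr
  consumed_eq : σ.consumed = t
  emitted_eq : σ.emitted = em

/-! ### Symbolic execution of the segments of the program -/

section

set_option linter.unusedSimpArgs false

variable {lam ε : ℝ} {B : ℕ} {x ω : ℕ → ℝ} {t em cnt dr N : ℕ} {acc : ℝ} {bit : ℕ → ℕ}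
  {leaf : ℕ → ℝ}

theorem reaches_config_init (hN : B + 9 < N) :
    ∃ σ, countingProgram.Reaches x ω N 14 (initialState lam ε B) σ ∧
      Config lam ε B x 14 0 0 0 0 0 (fun _ => 0) (fun _ => 0) σ := by
  unfold initialState
  iterate 14
    refine Program.exists_reaches_succ rfl (by
      simp [Instr.cells, State.natCells, State.realCells, Finset.insert_subset_iff]; try omega) ?_
    simp only [Instr.exec, State.setNat, State.setReal, State.addr, RealOp.eval]
  refine Program.exists_reaches_zero ?_
  constructor <;> simp [Function.update_apply]

theorem Config.reaches_output {σ : State} (hN : B + 9 < N)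
    (h : Config lam ε B x 38 t em cnt dr acc bit leaf σ) :
    ∃ σ', countingProgram.Reaches x ω N 2 σ σ' ∧
      Config lam ε B x 14 t (em + 1) cnt dr acc bit leaf σ' := by
  obtain ⟨pc, nat, real, drawn, consumed, emitted, last⟩ := σ
  obtain ⟨h1, h2, h3, h4, h5, h6, h7, h8, h9, h10, h11, h12, h13, h14, h15, h16, h17⟩ := h
  simp only at *
  subst h1
  iterate 2
    refine Program.exists_reaches_succ rfl (by
      simp [Instr.cells, State.natCells, State.realCells, Finset.insert_subset_iff]; try omega) ?_
    simp only [Instr.exec, State.setNat, State.setReal, State.addr, RealOp.eval, if_true]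
  refine Program.exists_reaches_zero ?_
  constructor <;> simp_all

theorem Config.reaches_skip {σ : State} (hN : B + 9 < N) (hcnt : cnt ≠ B)
    (h : Config lam ε B x 18 t em cnt dr acc bit leaf σ) :
    ∃ σ', countingProgram.Reaches x ω N 3 σ σ' ∧
      Config lam ε B x 38 t em (cnt + 1) dr acc bit leaf σ' := by
  obtain ⟨pc, nat, real, drawn, consumed, emitted, last⟩ := σ
  obtain ⟨h1, h2, h3, h4, h5, h6, h7, h8, h9, h10, h11, h12, h13, h14, h15, h16, h17⟩ := h
  simp only at *
  subst h1
  iterate 3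
    refine Program.exists_reaches_succ rfl (by
      simp [Instr.cells, State.natCells, State.realCells, Finset.insert_subset_iff]; try omega) ?_
    simp only [Instr.exec, State.setNat, State.setReal, State.addr, RealOp.eval, h2, h4,
      if_neg hcnt, if_true]
  refine Program.exists_reaches_zero ?_
  constructor <;> simp_all [Function.update_apply]

theorem Config.reaches_noise {σ : State} (hN : B + 9 < N)
    (h : Config lam ε B x 18 t em B dr acc bit leaf σ) :
    ∃ σ', countingProgram.Reaches x ω N 3 σ σ' ∧
      Config lam ε B x 25 t em B dr acc bit leaf σ' ∧ σ'.nat 4 = B + 0 + 9 ∧ σ'.nat 5 = 0 + 1 := by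
  obtain ⟨pc, nat, real, drawn, consumed, emitted, last⟩ := σ
  obtain ⟨h1, h2, h3, h4, h5, h6, h7, h8, h9, h10, h11, h12, h13, h14, h15, h16, h17⟩ := h
  simp only at *
  subst h1
  iterate 3
    refine Program.exists_reaches_succ rfl (by
      simp [Instr.cells, State.natCells, State.realCells, Finset.insert_subset_iff]; try omega) ?_
    simp only [Instr.exec, State.setNat, State.setReal, State.addr, RealOp.eval, h2, h3, h4,
      if_true]
  refine Program.exists_reaches_zero ?_
  refine ⟨?_, by simp, by simp⟩
  constructor <;> simp_all [Function.update_apply]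

theorem Config.reaches_refresh {σ : State} {l : ℕ} (hN : B + l + 9 < N)
    (h : Config lam ε B x 25 t em cnt dr acc bit leaf σ)
    (h18 : σ.nat 4 = B + l + 9) (h19 : σ.nat 5 = l + 1) (hbit : bit l = 1) :
    ∃ σ', countingProgram.Reaches x ω N 12 σ σ' ∧
      Config lam ε B x 25 t em cnt (dr + 1) (acc - leaf l + noiseScale lam ε l * ω dr)
        (Function.update bit l 0) (Function.update leaf l (noiseScale lam ε l * ω dr)) σ' ∧
      σ'.nat 4 = B + (l + 1) + 9 ∧ σ'.nat 5 = l + 1 + 1 := by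
  obtain ⟨pc, nat, real, drawn, consumed, emitted, last⟩ := σ
  obtain ⟨h1, h2, h3, h4, h5, h6, h7, h8, h9, h10, h11, h12, h13, h14, h15, h16, h17⟩ := h
  simp only at *
  subst h1
  have hv : ((l : ℝ) + 1) ^ (1 - lam) / ε = noiseScale lam ε l := by rw [noiseScale, add_comm]
  iterate 12
    refine Program.exists_reaches_succ rfl (by
      simp [Instr.cells, State.natCells, State.realCells, Finset.insert_subset_iff,
        Function.update_apply, h18]
      try omega) ?_
    simp [Instr.exec, State.setNat, State.setReal, State.addr, RealOp.eval, Function.update_apply,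
      h2, h3, h6, h7, h9, h10, h11, h14, h15, h18, h19, hbit, hv]
  refine Program.exists_reaches_zero ⟨?_, ?_, ?_⟩
  · constructor <;> simp_all [Function.update_apply]
    -- The buffer ends at cell `B + 8`, below every noise cell, so the write does not reach it.
    case real_fresh => intros; exfalso; omega
    case real_buffer =>
      intro u _ _ h
      have := Nat.mod_lt u (show 0 < B + 1 by omega)
      exfalso; omega
  · simp [h18]; omega
  · simp [h19]

theorem Config.reaches_last {σ : State} {l : ℕ} (hN : B + l + 9 < N)
    (h : Config lam ε B x 25 t em cnt dr acc bit leaf σ)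
    (h18 : σ.nat 4 = B + l + 9) (h19 : σ.nat 5 = l + 1) (hbit : bit l = 0) :
    ∃ σ', countingProgram.Reaches x ω N 9 σ σ' ∧
      Config lam ε B x 38 t em cnt (dr + 1) (acc - leaf l + noiseScale lam ε l * ω dr)
        (Function.update bit l 1) (Function.update leaf l (noiseScale lam ε l * ω dr)) σ' := by
  obtain ⟨pc, nat, real, drawn, consumed, emitted, last⟩ := σ
  obtain ⟨h1, h2, h3, h4, h5, h6, h7, h8, h9, h10, h11, h12, h13, h14, h15, h16, h17⟩ := h
  simp only at *
  subst h1
  have hv : ((l : ℝ) + 1) ^ (1 - lam) / ε = noiseScale lam ε l := by rw [noiseScale, add_comm]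
  iterate 9
    refine Program.exists_reaches_succ rfl (by
      simp [Instr.cells, State.natCells, State.realCells, Finset.insert_subset_iff,
        Function.update_apply, h18]
      try omega) ?_
    simp [Instr.exec, State.setNat, State.setReal, State.addr, RealOp.eval, Function.update_apply,
      h2, h3, h6, h7, h9, h10, h11, h14, h15, h18, h19, hbit, hv]
  refine Program.exists_reaches_zero ?_
  constructor <;> simp_all [Function.update_apply]
  case real_fresh => intros; exfalso; omega
  case real_buffer =>
    intro u _ _ h
    have := Nat.mod_lt u (show 0 < B + 1 by omega)
    exfalso; omega

theorem Config.reaches_read {σ : State} (hN : B + 9 < N)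
    (h : Config lam ε B x 14 t em cnt dr acc bit leaf σ) :
    ∃ n ≤ 6, ∃ σ', countingProgram.Reaches x ω N n σ σ' ∧
      Config lam ε B x 18 (t + 1) em cnt dr (acc + if t < B then 0 else x (t - B + 1)) bit leaf
        σ' := by
  obtain ⟨pc, nat, real, drawn, consumed, emitted, last⟩ := σ
  obtain ⟨h1, h2, h3, h4, h5, h6, h7, h8, h9, h10, h11, h12, h13, h14, h15, h16, h17⟩ := h
  simp only at *
  subst h1
  have hlt : t % (B + 1) < B + 1 := Nat.mod_lt _ (by omega)
  -- Distinct indices at distance at most `B` occupy different cells of the buffer.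
  have hbuf : ∀ u, u < t → t ≤ u + B → u % (B + 1) ≠ t % (B + 1) := by
    intro u hu1 hu2 h
    have h2 : B + 1 ∣ t - u := (Nat.modEq_iff_dvd' hu1.le).1 h
    have := Nat.le_of_dvd (by omega) h2
    omega
  have hval : Function.update real (t % (B + 1) + 8) (x (t + 1)) ((t + 1) % (B + 1) + 8) =
      if t < B then 0 else x (t - B + 1) := by
    split_ifs with htB
    · rw [Nat.mod_eq_of_lt (show t < B + 1 by omega), Nat.mod_eq_of_lt (show t + 1 < B + 1 by omega),
        Function.update_of_ne (by omega)]
      exact h12 _ (by omega) (by omega)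
    · have hmod' : (t + 1) % (B + 1) = (t - B) % (B + 1) := by
        rw [show t + 1 = t - B + (B + 1) by omega, Nat.add_mod_right]
      rw [hmod']
      -- Without delay the buffer has a single cell, and the entry read back is the one just
      -- written.
      rcases Nat.eq_zero_or_pos B with rfl | hB
      · simp
      · rw [Function.update_of_ne]
        · exact h13 _ (by omega) (by omega)
        · have := hbuf (t - B) (by omega) (by omega)
          omega
  have hmod : (t + 1) % (B + 1) = if t % (B + 1) = B then 0 else t % (B + 1) + 1 := by
    rw [← Nat.mod_add_mod]
    split_ifs with h
    · rw [h, Nat.mod_self]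
    · exact Nat.mod_eq_of_lt (by omega)
  by_cases hw : t % (B + 1) = B
  · refine ⟨6, le_rfl, ?_⟩
    rw [hmod, if_pos hw] at hval
    iterate 6
      refine Program.exists_reaches_succ rfl (by
        simp [Instr.cells, State.natCells, State.realCells, Finset.insert_subset_iff,
          Function.update_apply, h5]
        try omega) ?_
      simp [Instr.exec, State.setNat, State.setReal, State.addr, RealOp.eval, h3, h5, h6, h16, hw]
    refine Program.exists_reaches_zero ?_
    constructor <;> simp_all [Function.update_apply]
    case real_fresh =>
      intro i hi1 hi2
      have := Nat.mod_le t (B + 1)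
      rw [if_neg (by omega)]
      exact h12 i (by omega) hi2
    case real_buffer =>
      intro u hu1 hu2
      split_ifs with h
      · have : u = t := by
          by_contra hne
          exact hbuf u (by omega) (by omega) (by omega)
        rw [this]
      · exact h13 u (lt_of_le_of_ne hu1 (by rintro rfl; exact h hw))
          (by omega)
    case real_leaf => intros; exfalso; omega
  · refine ⟨4, by norm_num, ?_⟩
    rw [hmod, if_neg hw] at hval
    iterate 4
      refine Program.exists_reaches_succ rfl (by
        simp [Instr.cells, State.natCells, State.realCells, Finset.insert_subset_iff,
          Function.update_apply, h5]
        try omega) ?_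
      simp [Instr.exec, State.setNat, State.setReal, State.addr, RealOp.eval, h3, h5, h6, h16, hw]
    refine Program.exists_reaches_zero ?_
    constructor <;> simp_all [Function.update_apply]
    case real_fresh =>
      intro i hi1 hi2
      have := Nat.mod_le t (B + 1)
      rw [if_neg (by omega)]
      exact h12 i (by omega) hi2
    case real_buffer =>
      intro u hu1 hu2
      split_ifs with h
      · have : u = t := by
          by_contra hne
          exact hbuf u (by omega) (by omega) (by omega)
        rw [this]
      · exact h13 u (lt_of_le_of_ne hu1 (by rintro rfl; exact h rfl))
          (by omega)
    case real_leaf => intros; exfalso; omega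

end

/-! ### The order of the draws -/

/-- The number of noise variables drawn for the first `s` prefix sums. -/
def drawCount (s : ℕ) : ℕ := s + padicValNat 2 s.factorial

/-- The increment to `s + 1` visits the levels `0, …, v₂(s + 1)`, and these valuations add up to
that of the factorial. -/
theorem drawCount_succ (s : ℕ) :
    drawCount (s + 1) = drawCount s + (padicValNat 2 (s + 1) + 1) := by
  rw [drawCount, drawCount, Nat.factorial_succ,
    padicValNat.mul (Nat.add_one_ne_zero s) (Nat.factorial_ne_zero s)]
  omega

/-- Legendre's formula: `v₂(s!)` is `s` minus its binary digit sum. This is the amortized bound for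
the binary counter. -/
theorem drawCount_le (s : ℕ) : drawCount s ≤ 2 * s := by
  have h := sub_one_mul_padicValNat_factorial (p := 2) s
  rw [show 2 - 1 = 1 from rfl, one_mul] at h
  rw [drawCount, h]
  omega

theorem drawCount_strictMono : StrictMono drawCount :=
  strictMono_nat_of_lt_succ fun s => by rw [drawCount_succ]; omega

/-- The index of the draw of the noise variable of a dyadic interval. -/
def drawIndex (I : DyadicInterval) : ℕ := drawCount (I.k * 2 ^ I.level - 1) + I.level

/-- The variable of an interval is drawn when the counter reaches its left end, whose valuation is
at least the level. -/
theorem drawIndex_mem (I : DyadicInterval) :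
    drawCount (I.k * 2 ^ I.level - 1) ≤ drawIndex I ∧
      drawIndex I < drawCount (I.k * 2 ^ I.level - 1 + 1) := by
  have hpos : I.k * 2 ^ I.level ≠ 0 := (Nat.mul_pos I.k_pos (Nat.two_pow_pos _)).ne'
  have h1 : I.level ≤ padicValNat 2 (I.k * 2 ^ I.level) :=
    (padicValNat_dvd_iff_le hpos).1 (Nat.dvd_mul_left _ _)
  rw [drawCount_succ, Nat.sub_add_cancel (Nat.pos_of_ne_zero hpos), drawIndex]
  omega

/-- The blocks of draws of different increments are disjoint, so the index determines the left end,
and its offset in the block the level. Injectivity yields independence of the noise variables. -/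
theorem drawIndex_injective : Function.Injective drawIndex := by
  intro I J h
  have hI := drawIndex_mem I
  have hJ := drawIndex_mem J
  have hIpos := Nat.mul_pos I.k_pos (Nat.two_pow_pos I.level)
  have hJpos := Nat.mul_pos J.k_pos (Nat.two_pow_pos J.level)
  have h1 := drawCount_strictMono.lt_iff_lt.1 (hI.1.trans_lt (h ▸ hJ.2))
  have h2 := drawCount_strictMono.lt_iff_lt.1 (hJ.1.trans_lt (h ▸ hI.2))
  have hend : I.k * 2 ^ I.level = J.k * 2 ^ J.level := by omega
  have hl : I.level = J.level := by
    rw [drawIndex, drawIndex, hend] at h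
    omega
  obtain ⟨l, k, hk⟩ := I
  obtain ⟨l', k', hk'⟩ := J
  simp only at hl hend
  subst hl
  have := Nat.eq_of_mul_eq_mul_right (Nat.two_pow_pos l) hend
  subst this
  rfl

/-! ### The noise along the binary counter -/

section

variable (lam ε : ℝ) (x ω : ℕ → ℝ)

/-- The noise variable of the `k`-th dyadic interval of level `l`, and `0` for `k = 0`. -/
noncomputable def noiseValue (l k : ℕ) : ℝ :=
  if k = 0 then 0 else noiseScale lam ε l * ω (drawCount (k * 2 ^ l - 1) + l)

/-- The noisy sum of the first `s` entries of the stream. -/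
noncomputable def noisySum (s : ℕ) : ℝ :=
  ∑ i ∈ Finset.Icc 1 s, x i + ∑ l ∈ Finset.range (s + 1), noiseValue lam ε ω l (s / 2 ^ l)

variable {lam ε x ω}

theorem noiseValue_zero (l : ℕ) : noiseValue lam ε ω l 0 = 0 := if_pos rfl

theorem noiseValue_of_dvd {l s : ℕ} (hl : 2 ^ l ∣ s + 1) :
    noiseValue lam ε ω l ((s + 1) / 2 ^ l) = noiseScale lam ε l * ω (drawCount s + l) := by
  rw [noiseValue, if_neg, Nat.div_mul_cancel hl, Nat.add_sub_cancel]
  exact (Nat.div_pos (Nat.le_of_dvd (Nat.succ_pos s) hl) (Nat.two_pow_pos l)).ne'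

/-- The levels above `log₂` of the prefix length have index 0 and contribute nothing, so the fixed
range of levels in `noisySum` is harmless. -/
theorem noisySum_eq_output {B : ℕ} (t : ℕ) :
    noisySum lam ε x ω (t - B) = (countingMechanism lam ε B).output x t
      (fun I => noiseScale lam ε I.level * ω (drawIndex I)) := by
  simp only [countingMechanism, noisySum]
  split_ifs with h
  · rw [Nat.sub_eq_zero_of_le h]
    simp [noiseValue_zero]
  · congr 1
    have hs : 1 ≤ t - B := by omega
    generalize t - B = s at hs
    rw [sum_dyadicAt hs]
    have hlog : Nat.log 2 s < s := Nat.log_lt_self 2 (by omega)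
    rw [← Finset.sum_subset (Finset.range_subset_range.2 (show Nat.log 2 s + 1 ≤ s + 1 by omega))]
    · refine Finset.sum_congr rfl fun l hl => ?_
      have hk : 1 ≤ s / 2 ^ l := (Nat.one_le_div_iff (by positivity)).2
        (Nat.pow_le_of_le_log (by omega) (by rw [Finset.mem_range] at hl; omega))
      simp only [dyadicIntervalAt, drawIndex, noiseValue, max_eq_right hk]
      rw [if_neg (by omega)]
    · intro l _ hl
      rw [Finset.mem_range, not_lt] at hl
      rw [Nat.div_eq_of_lt (Nat.lt_pow_of_log_lt one_lt_two (by omega)), noiseValue_zero]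

theorem succ_div_two_pow_of_lt {s l : ℕ} (hl : padicValNat 2 (s + 1) < l) :
    (s + 1) / 2 ^ l = s / 2 ^ l := by
  rw [Nat.succ_div, if_neg, add_zero]
  rw [padicValNat_dvd_iff_le (Nat.add_one_ne_zero s)]
  omega

/-- The interval of level `l` changes between `s` and `s + 1` only if `2 ^ l ∣ s + 1`, that is, for
`l ≤ v₂(s + 1)`. -/
theorem noisySum_succ (s : ℕ) :
    noisySum lam ε x ω (s + 1) = noisySum lam ε x ω s + x (s + 1) +
      ∑ l ∈ Finset.range (padicValNat 2 (s + 1) + 1),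
        (noiseValue lam ε ω l ((s + 1) / 2 ^ l) - noiseValue lam ε ω l (s / 2 ^ l)) := by
  have hv : padicValNat 2 (s + 1) < s + 1 := by
    have h1 := Nat.le_of_dvd (Nat.succ_pos s) (pow_padicValNat_dvd (p := 2) (n := s + 1))
    exact Nat.lt_two_pow_self.trans_le h1
  have hsub : ∑ l ∈ Finset.range (padicValNat 2 (s + 1) + 1),
        (noiseValue lam ε ω l ((s + 1) / 2 ^ l) - noiseValue lam ε ω l (s / 2 ^ l)) =
      ∑ l ∈ Finset.range (s + 1 + 1),
        (noiseValue lam ε ω l ((s + 1) / 2 ^ l) - noiseValue lam ε ω l (s / 2 ^ l)) := by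
    refine Finset.sum_subset (Finset.range_subset_range.2 (by omega)) fun l _ hl => ?_
    rw [Finset.mem_range, not_lt] at hl
    rw [succ_div_two_pow_of_lt (by omega), sub_self]
  have hlast : s / 2 ^ (s + 1) = 0 :=
    Nat.div_eq_of_lt ((Nat.lt_succ_self s).trans Nat.lt_two_pow_self)
  rw [hsub, Finset.sum_sub_distrib, Finset.sum_range_succ (fun l => noiseValue lam ε ω l (s / 2 ^ l)),
    hlast, noiseValue_zero, add_zero, noisySum, noisySum, Finset.sum_Icc_succ_top (by omega)]
  ring

/-- Translates the test of the program on bit `l` into divisibility: the carry arriving at level `l`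
continues exactly when the next power of two divides `s + 1`. -/
theorem div_two_pow_mod_two_of_dvd {s l : ℕ} (hl : 2 ^ l ∣ s + 1) :
    s / 2 ^ l % 2 = if 2 ^ (l + 1) ∣ s + 1 then 1 else 0 := by
  obtain ⟨m, hm⟩ := hl
  have hpos := Nat.two_pow_pos l
  obtain ⟨m, rfl⟩ : ∃ m', m = m' + 1 := Nat.exists_eq_succ_of_ne_zero (by rintro rfl; omega)
  have h1 : s = 2 ^ l * m + (2 ^ l - 1) := by rw [mul_add_one] at hm; omega
  have h2 : 2 ^ (l + 1) ∣ s + 1 ↔ 2 ∣ m + 1 := by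
    rw [hm, pow_succ, Nat.mul_dvd_mul_iff_left hpos]
  have h3 : s / 2 ^ l = m := by
    rw [h1, Nat.mul_add_div hpos, Nat.div_eq_of_lt (by omega), add_zero]
  rw [h3]
  split_ifs <;> omega

theorem Config.reaches_increment {B N t em s : ℕ} {acc : ℝ} {σ : State}
    (hN : B + Nat.log 2 (s + 1) + 9 < N)
    (h : Config lam ε B x 18 t em B (drawCount s) acc (fun l => s / 2 ^ l % 2)
      (fun l => noiseValue lam ε ω l (s / 2 ^ l)) σ) :
    ∃ σ', countingProgram.Reaches x ω N (12 * padicValNat 2 (s + 1) + 12) σ σ' ∧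
      Config lam ε B x 38 t em B (drawCount (s + 1))
        (acc + ∑ l ∈ Finset.range (padicValNat 2 (s + 1) + 1),
          (noiseValue lam ε ω l ((s + 1) / 2 ^ l) - noiseValue lam ε ω l (s / 2 ^ l)))
        (fun l => (s + 1) / 2 ^ l % 2) (fun l => noiseValue lam ε ω l ((s + 1) / 2 ^ l)) σ' := by
  set v := padicValNat 2 (s + 1) with hv
  have hvlog : v ≤ Nat.log 2 (s + 1) := Nat.le_log_of_pow_le one_lt_two
    (Nat.le_of_dvd (Nat.succ_pos s) (pow_padicValNat_dvd (p := 2) (n := s + 1)))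
  have hdvd : ∀ l, 2 ^ l ∣ s + 1 ↔ l ≤ v := fun l => padicValNat_dvd_iff_le (Nat.add_one_ne_zero s)
  -- Loop invariant: the levels below `l` already have the bits and the noise of `s + 1`, the others
  -- still those of `s`.
  have hloop : ∀ l ≤ v, ∃ σ', countingProgram.Reaches x ω N (3 + 12 * l) σ σ' ∧
      Config lam ε B x 25 t em B (drawCount s + l)
        (acc + ∑ i ∈ Finset.range l,
          (noiseValue lam ε ω i ((s + 1) / 2 ^ i) - noiseValue lam ε ω i (s / 2 ^ i)))
        (fun i => if i < l then 0 else s / 2 ^ i % 2)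
        (fun i => noiseValue lam ε ω i ((if i < l then s + 1 else s) / 2 ^ i)) σ' ∧
      σ'.nat 4 = B + l + 9 ∧ σ'.nat 5 = l + 1 := by
    intro l
    induction l with
    | zero =>
      intro _
      obtain ⟨σ', h1, h2, h3⟩ := h.reaches_noise (ω := ω) (N := N) (by omega)
      exact ⟨σ', h1, by simpa using h2, h3⟩
    | succ l ih =>
      intro hl
      obtain ⟨σ₁, h1, h2, h3, h4⟩ := ih (by omega)
      obtain ⟨σ₂, h5, h6, h7, h8⟩ := h2.reaches_refresh (ω := ω) (N := N) (l := l) (by omega) h3 h4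
        (by
          simp only [lt_irrefl, if_false]
          rw [div_two_pow_mod_two_of_dvd ((hdvd l).2 (by omega)), if_pos ((hdvd _).2 hl)])
      refine ⟨σ₂, h1.trans h5, ?_, h7, h8⟩
      rw [← noiseValue_of_dvd ((hdvd l).2 (by omega))] at h6
      convert h6 using 1
      · omega
      · rw [Finset.sum_range_succ]
        simp only [lt_irrefl, if_false]
        ring
      · funext i
        rcases lt_trichotomy i l with hi | rfl | hi
        · rw [Function.update_of_ne hi.ne, if_pos hi, if_pos (by omega)]
        · rw [Function.update_self, if_pos (by omega)]
        · rw [Function.update_of_ne hi.ne', if_neg (by omega), if_neg (by omega)]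
      · funext i
        rcases lt_trichotomy i l with hi | rfl | hi
        · rw [Function.update_of_ne hi.ne, if_pos hi, if_pos (by omega)]
        · rw [Function.update_self, if_pos (by omega)]
        · rw [Function.update_of_ne hi.ne', if_neg (by omega), if_neg (by omega)]
  obtain ⟨σ₁, h1, h2, h3, h4⟩ := hloop v le_rfl
  obtain ⟨σ₂, h5, h6⟩ := h2.reaches_last (ω := ω) (N := N) (l := v) (by omega) h3 h4 (by
    simp only [lt_irrefl, if_false]
    rw [div_two_pow_mod_two_of_dvd ((hdvd v).2 le_rfl), if_neg (by rw [hdvd]; omega)])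
  refine ⟨σ₂, ?_, ?_⟩
  · have := h1.trans h5
    rwa [show 3 + 12 * v + 9 = 12 * v + 12 by ring] at this
  · rw [← noiseValue_of_dvd ((hdvd v).2 le_rfl)] at h6
    convert h6 using 1
    · rw [drawCount_succ]
      omega
    · rw [Finset.sum_range_succ]
      simp only [lt_irrefl, if_false]
      ring
    · funext i
      have hsd : (s + 1) / 2 ^ i = s / 2 ^ i + if 2 ^ i ∣ s + 1 then 1 else 0 := Nat.succ_div
      rcases lt_trichotomy i v with hi | rfl | hi
      · rw [Function.update_of_ne hi.ne, if_pos hi]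
        rw [if_pos ((hdvd i).2 hi.le)] at hsd
        have h7 := div_two_pow_mod_two_of_dvd ((hdvd i).2 hi.le)
        rw [if_pos ((hdvd _).2 hi)] at h7
        omega
      · rw [Function.update_self]
        rw [if_pos ((hdvd v).2 le_rfl)] at hsd
        have h7 := div_two_pow_mod_two_of_dvd ((hdvd v).2 le_rfl)
        rw [if_neg (by rw [hdvd]; omega)] at h7
        omega
      · rw [Function.update_of_ne hi.ne', if_neg (by omega), succ_div_two_pow_of_lt hi]
    · funext i
      rcases lt_trichotomy i v with hi | rfl | hi
      · rw [Function.update_of_ne hi.ne, if_pos hi]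
      · rw [Function.update_self]
      · rw [Function.update_of_ne hi.ne', if_neg (by omega), succ_div_two_pow_of_lt hi]

/-- The contents of the memory, at instruction `pc`, after `t` entries have been processed and
`em` outputs have been emitted. -/
def Processed (lam ε : ℝ) (B : ℕ) (x ω : ℕ → ℝ) (pc t em : ℕ) (σ : State) : Prop :=
  Config lam ε B x pc t em (min t B) (drawCount (t - B)) (noisySum lam ε x ω (t - B))
    (fun l => (t - B) / 2 ^ l % 2) (fun l => noiseValue lam ε ω l ((t - B) / 2 ^ l)) σ

/-- `drawCount` is the potential of the amortized analysis: a round costs at most 18 steps plus 12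
per draw. -/
theorem Processed.reaches_next {B N t : ℕ} {σ : State}
    (hN : B + Nat.log 2 (t + 1) + 9 < N) (h : Processed lam ε B x ω 14 t t σ) :
    ∃ n, n + 12 * drawCount (t - B) ≤ 18 + 12 * drawCount (t + 1 - B) ∧
      ∃ σ', countingProgram.Reaches x ω N n σ σ' ∧ Processed lam ε B x ω 38 (t + 1) t σ' := by
  obtain ⟨n, hn, σ₁, h1, h2⟩ := Config.reaches_read (ω := ω) (N := N) (by omega) h
  rcases Nat.lt_or_ge t B with ht | ht
  · rw [min_eq_left ht.le, if_pos ht, add_zero] at h2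
    obtain ⟨σ₂, h3, h4⟩ := h2.reaches_skip (ω := ω) (N := N) (by omega) ht.ne
    have e : t - B = t + 1 - B := by omega
    refine ⟨n + 3, by rw [e]; omega, σ₂, h1.trans h3, ?_⟩
    rw [Processed, min_eq_left ht, ← e]
    exact h4
  · rw [min_eq_right ht, if_neg (by omega)] at h2
    have hlog : Nat.log 2 (t - B + 1) ≤ Nat.log 2 (t + 1) := Nat.log_mono_right (by omega)
    obtain ⟨σ₂, h3, h4⟩ := h2.reaches_increment (N := N) (by omega)
    have e : t + 1 - B = t - B + 1 := by omega
    refine ⟨_, ?_, σ₂, h1.trans h3, ?_⟩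
    · rw [e, drawCount_succ]
      omega
    · rw [Processed, min_eq_right (by omega), e, noisySum_succ]
      exact h4

theorem exists_reaches_processed {B N : ℕ} (t : ℕ) (hN : B + Nat.log 2 t + 9 < N) :
    ∃ n ≤ 14 + 20 * t + 12 * drawCount (t - B), ∃ σ,
      countingProgram.Reaches x ω N n (initialState lam ε B) σ ∧
        Processed lam ε B x ω 14 t t σ := by
  induction t with
  | zero =>
    obtain ⟨σ, h1, h2⟩ := reaches_config_init (lam := lam) (ε := ε) (B := B) (x := x) (ω := ω)
      (N := N) (by omega)
    refine ⟨14, by omega, σ, h1, ?_⟩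
    simpa [Processed, drawCount, noisySum, noiseValue_zero] using h2
  | succ t ih =>
    have hlog : Nat.log 2 t ≤ Nat.log 2 (t + 1) := Nat.log_mono_right (by omega)
    obtain ⟨n, hn, σ, h1, h2⟩ := ih (by omega)
    obtain ⟨m, hm, σ', h3, h4⟩ := h2.reaches_next hN
    obtain ⟨σ'', h5, h6⟩ := Config.reaches_output (ω := ω) (N := N) (by omega) h4
    exact ⟨n + m + 2, by omega, σ'', (h1.trans h3).trans h5, h6⟩

/-! ### Outputs, time and space -/

theorem Program.emitted_run_mono (P : Program) (lam ε : ℝ) (B : ℕ) (x ω : ℕ → ℝ) :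
    Monotone fun n => (P.run lam ε B x ω n).emitted := by
  refine monotone_nat_of_le_succ fun n => ?_
  simp only [Program.run, Function.iterate_succ_apply', Program.step]
  split
  · rename_i i _
    cases i <;> simp [Instr.exec, State.setNat, State.setReal]
  · exact le_rfl

theorem countingProgram_output (lam ε : ℝ) (B : ℕ) (x ω : ℕ → ℝ) {t : ℕ} (ht : 1 ≤ t) :
    countingProgram.outputAt lam ε B x ω t = noisySum lam ε x ω (t - B) ∧
      countingProgram.EmitsWithin lam ε B x ω t (60 * t)
        (20 * (1 + B + Real.logb 2 t)) := by
  obtain ⟨t, rfl⟩ : ∃ t', t = t' + 1 := ⟨t - 1, by omega⟩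
  set N := B + Nat.log 2 (t + 1) + 10 with hN
  have hlog : Nat.log 2 t ≤ Nat.log 2 (t + 1) := Nat.log_mono_right (by omega)
  obtain ⟨n, hn, σ, h1, h2⟩ := exists_reaches_processed (lam := lam) (ε := ε) (x := x) (ω := ω)
    (B := B) (N := N) t (by omega)
  obtain ⟨m, hm, σ', h3, h4⟩ := h2.reaches_next (N := N) (by omega)
  have h5 := h1.trans h3
  have hstep : countingProgram.step x ω σ' = Instr.exec x ω σ' (.output (.direct 2)) := by
    rw [Program.step, h4.pc_eq]
    rfl
  have hrun : countingProgram.run lam ε B x ω (n + m) = σ' := h5.1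
  have hrun' : countingProgram.run lam ε B x ω (n + m + 1) =
      Instr.exec x ω σ' (.output (.direct 2)) := by
    rw [← hstep, ← hrun, Program.run, Function.iterate_succ_apply']
    rfl
  -- The number of outputs is monotone in time and is still `t` after `n + m` steps, so the next
  -- step is the first with `t + 1` outputs.
  have htime : countingProgram.outputTime lam ε B x ω (t + 1) = n + m + 1 := by
    rw [Program.outputTime]
    refine le_antisymm (Nat.sInf_le ?_) (le_csInf ⟨n + m + 1, ?_⟩ fun k hk => ?_)
    · simp [hrun', Instr.exec, h4.emitted_eq]
    · simp [hrun', Instr.exec, h4.emitted_eq]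
    · by_contra hlt
      have hmono := countingProgram.emitted_run_mono lam ε B x ω (show k ≤ n + m by omega)
      simp only [hrun, h4.emitted_eq] at hmono
      simp only [Set.mem_ofPred_eq] at hk
      omega
  have hdraw := drawCount_le (t + 1 - B)
  refine ⟨?_, ?_, ?_, ?_, ?_⟩
  · rw [Program.outputAt, htime, hrun']
    exact h4.real_two
  · rw [htime, hrun']
    simp [Instr.exec, h4.emitted_eq]
  · rw [htime, hrun']
    simp [Instr.exec, State.addr, h4.consumed_eq]
  · rw [htime]
    exact_mod_cast (by omega : n + m + 1 ≤ 60 * (t + 1))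
  · rw [htime]
    have hsub : ((Finset.range (n + m + 1)).biUnion fun k =>
        countingProgram.cellsAt (countingProgram.run lam ε B x ω k)) ⊆ cellsBelow N := by
      refine Finset.biUnion_subset.2 fun k hk => ?_
      rcases Nat.lt_or_ge k (n + m) with hkn | hkn
      · exact h5.2 k hkn
      · have : k = n + m := by rw [Finset.mem_range] at hk; omega
        rw [this, hrun, Program.cellsAt, h4.pc_eq]
        simp [countingProgram, Instr.cells, State.realCells]
        omega
    have hcard : countingProgram.cellsUsed lam ε B x ω (n + m + 1) ≤ 2 * N :=
      (Finset.card_le_card hsub).trans_eq (card_cellsBelow N)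
    have hl := nat_log_le_logb (s := t + 1) (t := t + 1) (by omega) le_rfl
    have hB : (0 : ℝ) ≤ B := Nat.cast_nonneg B
    have hL : (0 : ℝ) ≤ Nat.log 2 (t + 1) := Nat.cast_nonneg _
    refine (Nat.cast_le.2 hcard).trans ?_
    rw [hN]
    push_cast at hl ⊢
    linarith

/-- After the noise is written as rescaled entries of the source, both output sequences are the same
function of `ω`, so the laws agree jointly in all times. -/
theorem countingProgram_implements {ε : ℝ} (hε : 0 < ε) (lam : ℝ) (B : ℕ) (x : ℕ → ℝ) :
    countingProgram.Implements lam ε B x := by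
  have hm : Measurable fun (ω : ℕ → ℝ) (I : DyadicInterval) =>
      noiseScale lam ε I.level * ω (drawIndex I) := by fun_prop
  rw [Program.Implements, ← map_sourceLaw_eq_noiseLaw (noiseScale_pos lam hε) drawIndex_injective,
    Measure.map_map (measurable_pi_lambda _ fun t =>
      (countingMechanism lam ε B).measurable_output x t) hm]
  congr 1
  funext ω t
  -- Index 0 is part of the sequences, and both sides have the default value 0 there.
  rcases Nat.eq_zero_or_pos t with rfl | ht
  · have : countingProgram.outputTime lam ε B x ω 0 = 0 := by simp [Program.outputTime]
    simp [Program.outputAt, this, Program.run, initialState, countingMechanism]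
  · rw [(countingProgram_output lam ε B x ω ht).1, noisySum_eq_output]
    rfl

end

end GradualExpiration

/-! ### Assembly -/

theorem theorem1 :
    ∃ P : GradualExpiration.Program,
    ∀ lam : ℝ, 0 < lam → lam ≠ 3 / 2 →
      (∃ C : ℝ, 0 < C ∧ ∀ ε : ℝ, 0 < ε → ∀ B : ℕ,
        -- privacy with every expiration function above the stated one
        (∀ f : ℕ → ℝ, Monotone f →
          (∀ d, GradualExpiration.expirationBound C lam B d ≤ f d) →
          GradualExpiration.IsDPWithExpiration
            (GradualExpiration.countingMechanism lam ε B) (Set.Icc 0 1) ε f) ∧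
        ∀ x : ℕ → ℝ, GradualExpiration.IsStreamIn (Set.Icc 0 1) x →
          -- the program implements the algorithm
          P.Implements lam ε B x ∧
          ∀ t : ℕ, 1 ≤ t →
            -- total time of the first `t` input/output pairs, and space
            (∀ ω : ℕ → ℝ,
              P.EmitsWithin lam ε B x ω t (C * t) (C * (1 + B + Real.logb 2 t))) ∧
            -- expected squared error
            MeasureTheory.Integrable
              (fun z => GradualExpiration.errorAt lam ε B x t z ^ 2)
              (GradualExpiration.countingMechanism lam ε B).law ∧
            ∫ z, GradualExpiration.errorAt lam ε B x t z ^ 2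
                ∂(GradualExpiration.countingMechanism lam ε B).law
              ≤ C * ((B : ℝ) ^ 2 + (1 + Real.logb 2 t ^ (3 - 2 * lam)) / ε ^ 2) ∧
            -- error with high probability, for every failure probability
            ∀ β : ℝ, 0 < β → β < 1 →
              1 - β ≤ (GradualExpiration.countingMechanism lam ε B).law.real
                {z | |GradualExpiration.errorAt lam ε B x t z| ≤
                  C * (B + (Real.logb 2 t ^ max (1 / 2) (3 / 2 - lam)
                          * Real.sqrt (Real.logb 2 (1 / β))
                        + (1 + Real.logb 2 t ^ (1 - lam)) * Real.logb 2 (1 / β)) / ε)}) ∧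
      -- error with high probability, for failure probabilities that are polynomial in `1 / t`
      ∀ c : ℝ, 0 < c → ∃ C : ℝ, 0 < C ∧ ∀ ε : ℝ, 0 < ε → ∀ B : ℕ,
        ∀ x : ℕ → ℝ, GradualExpiration.IsStreamIn (Set.Icc 0 1) x →
          ∀ t : ℕ, 1 ≤ t → ∀ β : ℝ, 0 < β → β < 1 → (t : ℝ) ^ (-c) ≤ β →
            1 - β ≤ (GradualExpiration.countingMechanism lam ε B).law.real
              {z | |GradualExpiration.errorAt lam ε B x t z| ≤
                C * (B + Real.logb 2 t ^ max (1 / 2) (3 / 2 - lam)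
                        * Real.sqrt (Real.logb 2 (1 / β)) / ε)} := by
  open GradualExpiration in
  refine ⟨countingProgram, fun lam hlam hlam' => ⟨?_, fun c hc => ?_⟩⟩
  · obtain ⟨C₁, hC₁, h₁⟩ := exists_isDPWithExpiration hlam
    obtain ⟨C₂, hC₂, h₂⟩ := exists_integral_sq_errorAt_le hlam'
    obtain ⟨C₃, hC₃, h₃⟩ := exists_errorAt_concentration hlam'
    -- All bounds are monotone in the constant; 60 is the step constant of the program and dominates
    -- its space constant 20.
    refine ⟨60 + C₁ + C₂ + C₃, by positivity, fun ε hε B => ⟨?_, fun x hx => ⟨?_, fun t ht => ?_⟩⟩⟩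
    · exact h₁ _ (by linarith) ε hε B _
    · exact countingProgram_implements hε lam B x
    have hl := Real.logb_nonneg one_lt_two (show (1 : ℝ) ≤ t by exact_mod_cast ht)
    refine ⟨fun ω => ?_, (h₂ ε hε B x hx t ht).1, (h₂ ε hε B x hx t ht).2.trans ?_,
      h₃ _ (by linarith) ε hε B x hx t ht⟩
    · obtain ⟨e1, e2, e3, e4⟩ := (countingProgram_output lam ε B x ω ht).2
      refine ⟨e1, e2, e3.trans ?_, e4.trans ?_⟩ <;> gcongr <;> linarith
    · have := Real.rpow_nonneg hl (3 - 2 * lam)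
      gcongr
      linarith
  · obtain ⟨C, hC, h⟩ := exists_errorAt_concentration_of_rpow_le hlam' hc
    exact ⟨C, hC, h⟩
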